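/- Let $\mathbb K\in\{\mathbb R,\mathbb C\}$ and $n\ge 1$. For a vector space $E$ let $\otimes^{n,s}E\subseteq E\otimes\cdots\otimes E$ be the linear span of the powers $\otimes^n x=x\otimes\cdots\otimes x$ $(x\in E)$, and write $x_1\vee\cdots\vee x_n=\frac1{n!}\sum_{\sigma}x_{\sigma(1)}\otimes\cdots\otimes x_{\sigma(n)}\in\otimes^{n,s}E$. Let $\beta$ be a (finitely generated) s-tensor norm of order $n$: it assigns to each Banach space $E$ over $\mathbb K$ a norm $\beta(\,\cdot\,;\otimes^{n,s}E)$ on $\otimes^{n,s}E$ such that $\varepsilon_{n,s}\le\beta\le\pi_{n,s}$ (the injective and projective symmetric tensor norms), $\beta((\otimes^{n,s}T)z;\otimes^{n,s}F)\le\|T\|^n\beta(z;\otimes^{n,s}E)$ for each operator $T\in\mathcal L(E,F)$ and each $z\in\otimes^{n,s}E$, and $$\beta(z;\otimes^{n,s}E)=\inf\{\beta(z;\otimes^{n,s}M): M\subseteq E \text{ finite-dimensional},\ z\in\otimes^{n,s}M\}.$$ The last formula also defines $\beta$ on $\otimes^{n,s}E$ for a normed space $E$ that is not complete. The dual norm $\beta'$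 is defined on finite-dimensional $M$ by $\otimes^{n,s}_{\beta'}M=(\otimes^{n,s}_\beta M')'$ isometrically, through the duality $\langle\otimes^n x,\otimes^n\varphi\rangle=\varphi(x)^n$, and on every normed space by the same infimum over finite-dimensional subspaces. Write $\otimes^{n,s}_\beta E$ for $\otimes^{n,s}E$ with the norm $\beta$, $\widetilde\otimes^{n,s}_\beta E$ for its completion, and $E\otimes_{\pi_2}F$, $E\otimes_{\varepsilon_2}F$ for the (uncompleted) projective and injective tensor products. A Banach algebra is a Banach space with an associative continuous bilinear multiplication (not necessarily unital or contractive); $m(A):A\otimes_{\pi_2}A\to A$ denotes the linear map induced by the multiplication of $A$. **Theorem.** The following conditions are equivalent. 1. For every Banach algebra $A$, $\widetilde\otimes^{n,s}_\beta A$ is a Banach algebra with the natural multiplication, determined by $(\otimes^n a)(\otimes^n b)=\otimes^n(ab)$. 2. For all Banach spaces $E$ and $F$ there is a continuous linear map $$f:(\otimes^{n,s}_\beta E)\otimes_{\pi_2}(\otimes^{n,s}_\beta F)\to\otimes^{n,s}_\beta(E\otimes_{\pi_2}F),\qquad f\big((\otimes^n x)\otimes(\otimes^n y)\big)=\otimes^n(x\otimes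 y).$$ 3. For all Banach spaces $E$ and $F$ the natural map $$g:\otimes^{n,s}_{\beta'}(E\otimes_{\varepsilon_2}F)\to(\otimes^{n,s}_{\beta'}E)\otimes_{\varepsilon_2}(\otimes^{n,s}_{\beta'}F)$$ is continuous, where $g$ is the linear map determined by $g\big((x_1\otimes y_1)\vee\cdots\vee(x_n\otimes y_n)\big)=(x_1\vee\cdots\vee x_n)\otimes(y_1\vee\cdots\vee y_n)$; in particular $g(\otimes^n(x\otimes y))=(\otimes^n x)\otimes(\otimes^n y)$. 4. For all Banach spaces $E$ and $F$ there is a continuous linear map $$h:\otimes^{n,s}_{\beta'}\mathcal L(E,F)\to\mathcal L(\otimes^{n,s}_\beta E,\otimes^{n,s}_{\beta'}F),\qquad h(\otimes^n T)(\otimes^n x)=\otimes^n(Tx).$$ If one, hence all, of these conditions hold, then there are constants $c_1,c_2,c_3,c_4$ such that $\|m(\widetilde\otimes^{n,s}_\beta A)\|\le c_1\|m(A)\|^n$ for every Banach algebra $A$, and $\|f\|\le c_2$, $\|g\|\le c_3$, $\|h\|\le c_4$ for all Banach spaces $E$ and $F$. Each of the four constants has a least possible value, and these four least values agree. -/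

import Mathlib

open scoped TensorProduct

universe u

noncomputable section

namespace BanachTensor

section Symmetric

variable (𝕜 : Type) [RCLike 𝕜] (n : ℕ)

/-- The subspace of symmetric tensors in `⨂ⁿ E`: the linear span of the powers `x ⊗ ⋯ ⊗ x`. -/
def symSubmodule (E : Type u) [AddCommGroup E] [Module 𝕜 E] :
    Submodule 𝕜 (⨂[𝕜] _ : Fin n, E) :=
  Submodule.span 𝕜 (Set.range fun x : E => PiTensorProduct.tprod 𝕜 fun _ : Fin n => x)

/-- The `n`-fold symmetric tensor product `⊗^{n,s} E`, as a vector space (without a norm). -/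
def SymTensor (E : Type u) [AddCommGroup E] [Module 𝕜 E] : Type u :=
  symSubmodule 𝕜 n E

instance (E : Type u) [AddCommGroup E] [Module 𝕜 E] : AddCommGroup (SymTensor 𝕜 n E) :=
  inferInstanceAs (AddCommGroup (symSubmodule 𝕜 n E))

instance (E : Type u) [AddCommGroup E] [Module 𝕜 E] : Module 𝕜 (SymTensor 𝕜 n E) :=
  inferInstanceAs (Module 𝕜 (symSubmodule 𝕜 n E))

namespace SymTensor

/-- The inclusion of `⊗^{n,s} E` into the full tensor product. -/
def incl (E : Type u) [AddCommGroup E] [Module 𝕜 E] :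
    SymTensor 𝕜 n E →ₗ[𝕜] ⨂[𝕜] _ : Fin n, E :=
  (symSubmodule 𝕜 n E).subtype

variable {E F G : Type u} [AddCommGroup E] [Module 𝕜 E] [AddCommGroup F] [Module 𝕜 F]
  [AddCommGroup G] [Module 𝕜 G]

/-- The power `⊗ⁿ x`. -/
def pow (x : E) : SymTensor 𝕜 n E :=
  ⟨PiTensorProduct.tprod 𝕜 fun _ => x, Submodule.subset_span ⟨x, rfl⟩⟩

variable {𝕜 n}

@[simp] theorem incl_pow (x : E) :
    incl 𝕜 n E (pow 𝕜 n x) = PiTensorProduct.tprod 𝕜 fun _ => x := rfl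

theorem incl_injective : Function.Injective (incl 𝕜 n E) := Subtype.val_injective

theorem incl_mem (z : SymTensor 𝕜 n E) : incl 𝕜 n E z ∈ symSubmodule 𝕜 n E := z.2

theorem induction {p : SymTensor 𝕜 n E → Prop} (hpow : ∀ x, p (pow 𝕜 n x)) (h0 : p 0)
    (hadd : ∀ z w, p z → p w → p (z + w)) (hsmul : ∀ (c : 𝕜) z, p z → p (c • z)) (z) : p z := by
  obtain ⟨z, hz⟩ := z
  refine Submodule.span_induction (p := fun z hz => p ⟨z, hz⟩) ?_ h0
    (fun x y hx hy => hadd ⟨x, hx⟩ ⟨y, hy⟩) (fun c x hx => hsmul c ⟨x, hx⟩) hz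
  rintro _ ⟨x, rfl⟩
  exact hpow x

/-- `⊗^{n,s} T : ⊗^{n,s} E → ⊗^{n,s} F`, the restriction of `T ⊗ ⋯ ⊗ T`. -/
def map (T : E →ₗ[𝕜] F) : SymTensor 𝕜 n E →ₗ[𝕜] SymTensor 𝕜 n F :=
  LinearMap.codRestrict (symSubmodule 𝕜 n F)
    ((PiTensorProduct.map fun _ => T) ∘ₗ incl 𝕜 n E) fun z => by
      induction z using SymTensor.induction with
      | hpow x => exact Submodule.subset_span ⟨T x, by simp⟩
      | h0 => simp
      | hadd z w hz hw => rw [map_add]; exact add_mem hz hw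
      | hsmul c z hz => rw [map_smul]; exact Submodule.smul_mem _ _ hz

theorem incl_map (T : E →ₗ[𝕜] F) (z : SymTensor 𝕜 n E) :
    incl 𝕜 n F (map T z) = PiTensorProduct.map (fun _ => T) (incl 𝕜 n E z) := rfl

@[simp] theorem map_pow (T : E →ₗ[𝕜] F) (x : E) :
    map T (pow 𝕜 n x) = pow 𝕜 n (T x) := by
  apply incl_injective; simp [incl_map]

theorem map_map (T : F →ₗ[𝕜] G) (S : E →ₗ[𝕜] F) (z : SymTensor 𝕜 n E) :
    map T (map S z) = map (T ∘ₗ S) z := by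
  induction z using SymTensor.induction with
  | hpow x => simp
  | h0 => simp
  | hadd z w hz hw => simp [hz, hw]
  | hsmul c z hz => simp [hz]

/-- The sign in the polarization formula. -/
theorem sum_sign (r : Fin n → Fin n) :
    ∑ s : Finset (Fin n), (if r ∈ Fintype.piFinset (fun _ => s) then
      ((-1 : 𝕜) ^ (Finset.univ \ s).card) else 0) = if Function.Bijective r then 1 else 0 := by
  classical
  have h := Finset.prod_add (fun _ : Fin n => (1 : 𝕜))
    (fun i => if i ∈ Set.range r then 0 else -1) Finset.univ
  rw [Finset.powerset_univ] at h
  have h1 : ∀ s : Finset (Fin n), ((∏ i ∈ s, (1 : 𝕜)) * ∏ i ∈ Finset.univ \ s,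
      (if i ∈ Set.range r then (0 : 𝕜) else -1)) =
      (if r ∈ Fintype.piFinset (fun _ => s) then ((-1 : 𝕜) ^ (Finset.univ \ s).card) else 0) := by
    intro s
    rw [Finset.prod_const_one, one_mul]
    split_ifs with hr
    · rw [← Finset.prod_const]
      refine Finset.prod_congr rfl fun i hi => if_neg ?_
      rintro ⟨j, rfl⟩
      simp only [Fintype.mem_piFinset] at hr
      simp [hr j] at hi
    · simp only [Fintype.mem_piFinset, not_forall] at hr
      obtain ⟨j, hj⟩ := hr
      exact Finset.prod_eq_zero (i := r j) (by simpa using hj) (by simp)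
  rw [← Finset.sum_congr rfl fun s _ => h1 s, ← h]
  split_ifs with hb
  · exact Finset.prod_eq_one fun i _ => by simp [hb.surjective.range_eq]
  · rw [← Finite.surjective_iff_bijective] at hb
    simp only [Function.Surjective, not_forall] at hb
    obtain ⟨i, hi⟩ := hb
    exact Finset.prod_eq_zero (Finset.mem_univ i) (by rw [if_neg (by simpa using hi)]; simp)

/-- The polarization formula, which shows that symmetrized elementary tensors lie in the span of
the powers. -/
theorem polarization (x : Fin n → E) :
    ∑ σ : Equiv.Perm (Fin n), PiTensorProduct.tprod 𝕜 (fun i => x (σ i)) =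
      ∑ s : Finset (Fin n), ((-1 : 𝕜) ^ (Finset.univ \ s).card) •
        PiTensorProduct.tprod 𝕜 (fun _ : Fin n => ∑ j ∈ s, x j) := by
  classical
  have h1 : ∀ s : Finset (Fin n), ((-1 : 𝕜) ^ (Finset.univ \ s).card) •
        PiTensorProduct.tprod 𝕜 (fun _ : Fin n => ∑ j ∈ s, x j) =
      ∑ r : Fin n → Fin n, (if r ∈ Fintype.piFinset (fun _ => s) then
      ((-1 : 𝕜) ^ (Finset.univ \ s).card) else 0) • PiTensorProduct.tprod 𝕜 (fun i => x (r i)) := by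
    intro s
    rw [MultilinearMap.map_sum_finset (PiTensorProduct.tprod 𝕜) (fun _ j => x j) (fun _ => s),
      Finset.smul_sum]
    simp only [ite_smul, zero_smul, Finset.sum_ite_mem, Finset.univ_inter]
  rw [Finset.sum_congr rfl fun s _ => h1 s, Finset.sum_comm]
  simp only [← Finset.sum_smul, sum_sign]
  simp only [ite_smul, one_smul, zero_smul]
  rw [← Finset.sum_filter, ← Finset.sum_subtype_eq_sum_filter]
  refine Finset.sum_bij' (fun σ _ => (⟨σ, σ.bijective⟩ : {r : Fin n → Fin n // r.Bijective}))
    (fun r _ => Equiv.ofBijective r.1 r.2) ?_ ?_ ?_ ?_ ?_ <;> intros <;> simp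

/-- The symmetric product `x₁ ∨ ⋯ ∨ xₙ = (1/n!) ∑_σ x_{σ 1} ⊗ ⋯ ⊗ x_{σ n}`. -/
def symProd (x : Fin n → E) : SymTensor 𝕜 n E :=
  ⟨(n.factorial : 𝕜)⁻¹ • ∑ σ : Equiv.Perm (Fin n), PiTensorProduct.tprod 𝕜 (fun i => x (σ i)), by
    rw [polarization]
    exact Submodule.smul_mem _ _ (Submodule.sum_mem _ fun s _ =>
      Submodule.smul_mem _ _ (Submodule.subset_span ⟨_, rfl⟩))⟩

theorem incl_symProd (x : Fin n → E) : incl 𝕜 n E (symProd x) =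
    (n.factorial : 𝕜)⁻¹ • ∑ σ : Equiv.Perm (Fin n), PiTensorProduct.tprod 𝕜 (fun i => x (σ i)) :=
  rfl

@[simp] theorem symProd_const (x : E) : symProd (fun _ => x) = pow 𝕜 n x := by
  apply incl_injective
  rw [incl_symProd]
  have : (n.factorial : 𝕜) ≠ 0 := by exact_mod_cast n.factorial_ne_zero
  simp [Finset.sum_const, Fintype.card_perm, ← Nat.cast_smul_eq_nsmul 𝕜, smul_smul, this]

theorem pow_smul (c : 𝕜) (x : E) : pow 𝕜 n (c • x) = c ^ n • pow 𝕜 n x := by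
  apply incl_injective
  simpa using (PiTensorProduct.tprod 𝕜).map_smul_univ (fun _ : Fin n => c) fun _ => x

/-- Every symmetric tensor lives on a finite-dimensional subspace. -/
theorem exists_finiteDimensional (z : SymTensor 𝕜 n E) : ∃ (M : Submodule 𝕜 E)
    (_ : FiniteDimensional 𝕜 M) (w : SymTensor 𝕜 n M), map M.subtype w = z := by
  induction z using SymTensor.induction with
  | hpow x =>
    exact ⟨𝕜 ∙ x, inferInstance, pow 𝕜 n ⟨x, Submodule.mem_span_singleton_self x⟩, by simp⟩
  | h0 => exact ⟨⊥, inferInstance, 0, by simp⟩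
  | hadd z w hz hw =>
    obtain ⟨M, hM, a, rfl⟩ := hz
    obtain ⟨N, hN, b, rfl⟩ := hw
    refine ⟨M ⊔ N, inferInstance, map (Submodule.inclusion le_sup_left) a +
      map (Submodule.inclusion le_sup_right) b, ?_⟩
    rw [map_add, map_map, map_map, Submodule.subtype_comp_inclusion,
      Submodule.subtype_comp_inclusion]
  | hsmul c z hz =>
    obtain ⟨M, hM, a, rfl⟩ := hz
    exact ⟨M, hM, c • a, by simp⟩

end SymTensor

end Symmetric

section Pairing

variable {𝕜 : Type} [RCLike 𝕜] {n : ℕ}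

theorem exists_smul_norm_le_one {E : Type u} [NormedAddCommGroup E] [NormedSpace 𝕜 E]
    (φ : StrongDual 𝕜 E) :
    ∃ (c : 𝕜) (φ' : StrongDual 𝕜 E), ‖φ'‖ ≤ 1 ∧ φ = c • φ' := by
  have hpos : (0 : ℝ) < ‖φ‖ + 1 := by positivity
  have hne : ((‖φ‖ + 1 : ℝ) : 𝕜) ≠ 0 := by exact_mod_cast hpos.ne'
  refine ⟨((‖φ‖ + 1 : ℝ) : 𝕜), ((‖φ‖ + 1 : ℝ) : 𝕜)⁻¹ • φ, ?_, by rw [smul_inv_smul₀ hne]⟩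
  rw [norm_smul, norm_inv, RCLike.norm_ofReal, abs_of_pos hpos, inv_mul_le_one₀ hpos]
  linarith

namespace SymTensor

variable {E F : Type u} [NormedAddCommGroup E] [NormedSpace 𝕜 E]
  [NormedAddCommGroup F] [NormedSpace 𝕜 F]

/-- The duality bracket between `⊗^{n,s} E` and `⊗^{n,s} E'`, characterized by
`⟨⊗ⁿ x, ⊗ⁿ φ⟩ = φ(x)ⁿ`. -/
def pairing : SymTensor 𝕜 n E →ₗ[𝕜] SymTensor 𝕜 n (StrongDual 𝕜 E) →ₗ[𝕜] 𝕜 :=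
  (PiTensorProduct.dualDistrib.flip ∘ₗ incl 𝕜 n E).compl₂
    (incl 𝕜 n (Module.Dual 𝕜 E) ∘ₗ map (ContinuousLinearMap.coeLM 𝕜))

theorem pairing_apply (z : SymTensor 𝕜 n E) (w : SymTensor 𝕜 n (StrongDual 𝕜 E)) :
    pairing z w = PiTensorProduct.dualDistrib
      (incl 𝕜 n (Module.Dual 𝕜 E) (map (ContinuousLinearMap.coeLM 𝕜) w)) (incl 𝕜 n E z) := rfl

@[simp] theorem pairing_pow_pow (x : E) (φ : StrongDual 𝕜 E) :
    pairing (pow 𝕜 n x) (pow 𝕜 n φ) = φ x ^ n := by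
  simp [pairing_apply]

theorem pairing_map_pow (T : E →L[𝕜] F) (z : SymTensor 𝕜 n E) (φ : StrongDual 𝕜 F) :
    pairing (map T.toLinearMap z) (pow 𝕜 n φ) = pairing z (pow 𝕜 n (φ.comp T)) := by
  induction z using SymTensor.induction with
  | hpow x => simp
  | h0 => simp
  | hadd z w hz hw => simp [hz, hw]
  | hsmul c z hz => simp [hz]

theorem dualDistrib_perm (φ : Fin n → Module.Dual 𝕜 E) (σ : Equiv.Perm (Fin n))
    (z : SymTensor 𝕜 n E) :
    PiTensorProduct.dualDistrib (PiTensorProduct.tprod 𝕜 fun i => φ (σ i)) (incl 𝕜 n E z) =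
      PiTensorProduct.dualDistrib (PiTensorProduct.tprod 𝕜 φ) (incl 𝕜 n E z) := by
  induction z using SymTensor.induction with
  | hpow x => simpa using Equiv.prod_comp σ fun i => φ i x
  | h0 => simp
  | hadd z w hz hw => simp [hz, hw]
  | hsmul c z hz => simp [hz]

theorem pairing_symProd (φ : Fin n → StrongDual 𝕜 E) (z : SymTensor 𝕜 n E) :
    pairing z (symProd φ) = PiTensorProduct.dualDistrib
      (PiTensorProduct.tprod 𝕜 fun i => (φ i : Module.Dual 𝕜 E)) (incl 𝕜 n E z) := by
  have : (n.factorial : 𝕜) ≠ 0 := by exact_mod_cast n.factorial_ne_zero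
  rw [pairing_apply, incl_map, incl_symProd]
  simp only [map_smul, map_sum, PiTensorProduct.map_tprod, LinearMap.smul_apply,
    LinearMap.sum_apply]
  have h1 : ∀ σ : Equiv.Perm (Fin n), PiTensorProduct.dualDistrib
      (PiTensorProduct.tprod 𝕜 fun i => ContinuousLinearMap.coeLM 𝕜 (φ (σ i))) (incl 𝕜 n E z) =
      PiTensorProduct.dualDistrib
        (PiTensorProduct.tprod 𝕜 fun i => (φ i : Module.Dual 𝕜 E)) (incl 𝕜 n E z) :=
    fun σ => dualDistrib_perm (fun i => (φ i : Module.Dual 𝕜 E)) σ z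
  simp only [h1]
  simp [Finset.sum_const, Fintype.card_perm, this]

/-- Symmetric tensors are separated by the powers of continuous functionals. -/
theorem eq_zero_of_pairing (z : SymTensor 𝕜 n E)
    (h : ∀ φ : StrongDual 𝕜 E, pairing z (pow 𝕜 n φ) = 0) : z = 0 := by
  have h' : ∀ w : SymTensor 𝕜 n (StrongDual 𝕜 E), pairing z w = 0 := by
    intro w
    induction w using SymTensor.induction with
    | hpow x => exact h x
    | h0 => simp
    | hadd z w hz hw => simp [hz, hw]
    | hsmul c z hz => simp [hz]
  obtain ⟨M, hM, w, rfl⟩ := exists_finiteDimensional z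
  suffices w = 0 by simp [this]
  apply incl_injective
  rw [map_zero]
  let b := Module.finBasis 𝕜 M
  refine (Basis.piTensorProduct fun _ : Fin n => b).ext_elem fun p => ?_
  choose ψ hψ _ using fun i => exists_extension_norm_eq M (LinearMap.toContinuousLinearMap (b.coord i))
  have key := h' (symProd fun i => ψ (p i))
  rw [pairing_symProd, incl_map] at key
  rw [map_zero, Finsupp.zero_apply, ← key]
  generalize incl 𝕜 n M w = t
  induction t using PiTensorProduct.induction_on with
  | smul_tprod r f => simp [hψ]
  | add x y hx hy => simp [hx, hy]

/-- The injective norm `ε_{n,s}`. -/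
def injNorm (z : SymTensor 𝕜 n E) : ℝ :=
  sSup {r | ∃ φ : StrongDual 𝕜 E, ‖φ‖ ≤ 1 ∧ r = ‖pairing z (pow 𝕜 n φ)‖}

/-- The projective norm `π_{n,s}`. -/
def projNorm (z : SymTensor 𝕜 n E) : ℝ :=
  sInf {r | ∃ l : List (𝕜 × E), z = (l.map fun p => p.1 • pow 𝕜 n p.2).sum ∧
    r = (l.map fun p => ‖p.1‖ * ‖p.2‖ ^ n).sum}

theorem exists_list (z : SymTensor 𝕜 n E) :
    ∃ l : List (𝕜 × E), z = (l.map fun p => p.1 • pow 𝕜 n p.2).sum := by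
  induction z using SymTensor.induction with
  | hpow x => exact ⟨[(1, x)], by simp⟩
  | h0 => exact ⟨[], by simp⟩
  | hadd z w hz hw =>
    obtain ⟨l, rfl⟩ := hz
    obtain ⟨l', rfl⟩ := hw
    exact ⟨l ++ l', by simp⟩
  | hsmul c z hz =>
    obtain ⟨l, rfl⟩ := hz
    exact ⟨l.map fun p => (c * p.1, p.2), by simp [Function.comp_def, mul_smul, List.smul_sum]⟩

theorem projNorm_pow_le (x : E) : projNorm (pow 𝕜 n x) ≤ ‖x‖ ^ n := by
  refine csInf_le ⟨0, ?_⟩ ⟨[(1, x)], by simp⟩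
  rintro _ ⟨l, _, rfl⟩
  refine List.sum_nonneg fun a ha => ?_
  obtain ⟨p, _, rfl⟩ := List.mem_map.1 ha
  positivity

theorem norm_pairing_bound (z : SymTensor 𝕜 n E) :
    ∃ C : ℝ, ∀ φ : StrongDual 𝕜 E, ‖φ‖ ≤ 1 → ‖pairing z (pow 𝕜 n φ)‖ ≤ C := by
  induction z using SymTensor.induction with
  | hpow x =>
    refine ⟨‖x‖ ^ n, fun φ hφ => ?_⟩
    rw [pairing_pow_pow, norm_pow]
    exact pow_le_pow_left₀ (norm_nonneg _) (by simpa using φ.le_of_opNorm_le hφ x) n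
  | h0 => exact ⟨0, by simp⟩
  | hadd z w hz hw =>
    obtain ⟨C, hC⟩ := hz
    obtain ⟨D, hD⟩ := hw
    exact ⟨C + D, fun φ hφ => by
      simpa using (norm_add_le _ _).trans (add_le_add (hC φ hφ) (hD φ hφ))⟩
  | hsmul c z hz =>
    obtain ⟨C, hC⟩ := hz
    exact ⟨‖c‖ * C, fun φ hφ => by
      simpa using mul_le_mul_of_nonneg_left (hC φ hφ) (norm_nonneg c)⟩

theorem norm_pairing_le_injNorm (z : SymTensor 𝕜 n E) (φ : StrongDual 𝕜 E) (hφ : ‖φ‖ ≤ 1) :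
    ‖pairing z (pow 𝕜 n φ)‖ ≤ injNorm z := by
  obtain ⟨C, hC⟩ := norm_pairing_bound z
  exact le_csSup ⟨C, by rintro _ ⟨φ, hφ, rfl⟩; exact hC φ hφ⟩ ⟨φ, hφ, rfl⟩

theorem injNorm_le (z : SymTensor 𝕜 n E) (C : ℝ)
    (h : ∀ φ : StrongDual 𝕜 E, ‖φ‖ ≤ 1 → ‖pairing z (pow 𝕜 n φ)‖ ≤ C) : injNorm z ≤ C :=
  csSup_le ⟨_, 0, by simp, rfl⟩ (by rintro _ ⟨φ, hφ, rfl⟩; exact h φ hφ)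

theorem injNorm_map_le (T : E →L[𝕜] F) (hT : ‖T‖ ≤ 1) (z : SymTensor 𝕜 n E) :
    injNorm (map T.toLinearMap z) ≤ injNorm z := by
  refine injNorm_le _ _ fun φ hφ => ?_
  rw [pairing_map_pow]
  exact norm_pairing_le_injNorm _ _ ((φ.opNorm_comp_le T).trans
    (mul_le_one₀ hφ (norm_nonneg _) hT))

theorem eq_zero_of_injNorm (z : SymTensor 𝕜 n E) (h : injNorm z ≤ 0) : z = 0 := by
  refine eq_zero_of_pairing z fun φ => ?_
  obtain ⟨c, φ', hφ', rfl⟩ := exists_smul_norm_le_one φ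
  have h1 := norm_le_zero_iff.1 ((norm_pairing_le_injNorm z φ' hφ').trans h)
  rw [pow_smul, map_smul, h1, smul_zero]

end SymTensor

end Pairing

section Norms

variable (𝕜 : Type) [RCLike 𝕜] (n : ℕ)

/-- A norm on `⊗^{n,s} M` for every finite-dimensional normed space `M`, which dominates `ε_{n,s}`
and does not increase under contractions. Both `β` and `β'` are first given in this form. -/
structure FinSTensorNorm where
  /-- the norm on `⊗^{n,s} M` -/
  norm : ∀ (M : Type u) [NormedAddCommGroup M] [NormedSpace 𝕜 M] [FiniteDimensional 𝕜 M],
    Seminorm 𝕜 (SymTensor 𝕜 n M)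
  injNorm_le : ∀ (M : Type u) [NormedAddCommGroup M] [NormedSpace 𝕜 M] [FiniteDimensional 𝕜 M]
    (z : SymTensor 𝕜 n M), z.injNorm ≤ norm M z
  map_le : ∀ (M N : Type u) [NormedAddCommGroup M] [NormedSpace 𝕜 M] [FiniteDimensional 𝕜 M]
    [NormedAddCommGroup N] [NormedSpace 𝕜 N] [FiniteDimensional 𝕜 N] (T : M →L[𝕜] N),
    ‖T‖ ≤ 1 → ∀ z, norm N (SymTensor.map T.toLinearMap z) ≤ norm M z

variable {𝕜 n}

namespace FinSTensorNorm

variable (α : FinSTensorNorm.{u} 𝕜 n) (E F : Type u) [NormedAddCommGroup E] [NormedSpace 𝕜 E]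
  [NormedAddCommGroup F] [NormedSpace 𝕜 F]

/-- The numbers `α(z; ⊗^{n,s} M)`, for `M` a finite-dimensional subspace of `E` with
`z ∈ ⊗^{n,s} M`. -/
def extSet (z : SymTensor 𝕜 n E) : Set ℝ :=
  {r | ∃ (M : Submodule 𝕜 E) (_ : FiniteDimensional 𝕜 M) (w : SymTensor 𝕜 n M),
    SymTensor.map M.subtype w = z ∧ r = α.norm M w}

/-- The extension of `α` to all normed spaces:
`α(z; ⊗^{n,s} E) = inf {α(z; ⊗^{n,s} M) : M ⊆ E finite-dimensional, z ∈ ⊗^{n,s} M}`. -/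
def ext (z : SymTensor 𝕜 n E) : ℝ := sInf (α.extSet E z)

variable {E F}

theorem extSet_nonempty (z : SymTensor 𝕜 n E) : (α.extSet E z).Nonempty := by
  obtain ⟨M, hM, w, hw⟩ := SymTensor.exists_finiteDimensional z
  exact ⟨_, M, hM, w, hw, rfl⟩

theorem extSet_nonneg (z : SymTensor 𝕜 n E) : ∀ r ∈ α.extSet E z, 0 ≤ r := by
  rintro _ ⟨M, hM, w, _, rfl⟩
  exact apply_nonneg _ _

theorem extSet_bddBelow (z : SymTensor 𝕜 n E) : BddBelow (α.extSet E z) :=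
  ⟨0, α.extSet_nonneg z⟩

theorem ext_le (M : Submodule 𝕜 E) [FiniteDimensional 𝕜 M] (w : SymTensor 𝕜 n M) :
    α.ext E (SymTensor.map M.subtype w) ≤ α.norm M w :=
  csInf_le (α.extSet_bddBelow _) ⟨M, inferInstance, w, rfl, rfl⟩

theorem le_ext (z : SymTensor 𝕜 n E) (C : ℝ) (h : ∀ (M : Submodule 𝕜 E)
    [FiniteDimensional 𝕜 M] (w : SymTensor 𝕜 n M), SymTensor.map M.subtype w = z →
      C ≤ α.norm M w) : C ≤ α.ext E z :=
  le_csInf (α.extSet_nonempty z) (by rintro _ ⟨M, hM, w, hw, rfl⟩; exact h M w hw)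

theorem injNorm_le_ext (z : SymTensor 𝕜 n E) : z.injNorm ≤ α.ext E z := by
  refine α.le_ext z _ fun M _ w hw => ?_
  rw [← hw]
  exact (SymTensor.injNorm_map_le M.subtypeL M.norm_subtypeL_le w).trans (α.injNorm_le M w)

theorem ext_map_le (T : E →L[𝕜] F) (hT : ‖T‖ ≤ 1) (z : SymTensor 𝕜 n E) :
    α.ext F (SymTensor.map T.toLinearMap z) ≤ α.ext E z := by
  refine α.le_ext z _ fun M _ w hw => ?_
  let S : M →L[𝕜] (M.map T.toLinearMap) :=
    (T.comp M.subtypeL).codRestrict _ fun x => Submodule.mem_map_of_mem x.2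
  have hS : ‖S‖ ≤ 1 := by
    refine S.opNorm_le_bound zero_le_one fun x => ?_
    have := T.le_of_opNorm_le hT (x : E)
    rw [one_mul] at this ⊢
    exact this
  have h := α.ext_le (M.map T.toLinearMap) (SymTensor.map S.toLinearMap w)
  refine le_trans (le_of_eq ?_) (h.trans (α.map_le _ _ S hS w))
  rw [← hw, SymTensor.map_map, SymTensor.map_map]
  rfl

theorem ext_zero : α.ext E 0 = 0 := by
  refine le_antisymm ?_ (le_csInf (α.extSet_nonempty 0) (α.extSet_nonneg 0))
  simpa using α.ext_le (⊥ : Submodule 𝕜 E) 0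

theorem ext_add_le (y z : SymTensor 𝕜 n E) : α.ext E (y + z) ≤ α.ext E y + α.ext E z := by
  refine le_of_forall_pos_le_add fun δ hδ => ?_
  obtain ⟨_, ⟨M, hM, a, rfl, rfl⟩, ha⟩ := Real.lt_sInf_add_pos (α.extSet_nonempty y) (half_pos hδ)
  obtain ⟨_, ⟨N, hN, b, rfl, rfl⟩, hb⟩ := Real.lt_sInf_add_pos (α.extSet_nonempty z) (half_pos hδ)
  change _ < α.ext E _ + _ at ha hb
  let i : M →L[𝕜] (M ⊔ N : Submodule 𝕜 E) :=
    M.subtypeL.codRestrict _ fun x => Submodule.mem_sup_left x.2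
  let j : N →L[𝕜] (M ⊔ N : Submodule 𝕜 E) :=
    N.subtypeL.codRestrict _ fun x => Submodule.mem_sup_right x.2
  have hi : ‖i‖ ≤ 1 := i.opNorm_le_bound zero_le_one fun x => by simp [i]
  have hj : ‖j‖ ≤ 1 := j.opNorm_le_bound zero_le_one fun x => by simp [j]
  have h := α.ext_le (M ⊔ N) (SymTensor.map i.toLinearMap a + SymTensor.map j.toLinearMap b)
  rw [map_add, SymTensor.map_map, SymTensor.map_map] at h
  have h1 := map_add_le_add (α.norm ↥(M ⊔ N)) (SymTensor.map i.toLinearMap a)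
    (SymTensor.map j.toLinearMap b)
  have h2 := α.map_le _ _ i hi a
  have h3 := α.map_le _ _ j hj b
  change α.ext E (SymTensor.map M.subtype a + SymTensor.map N.subtype b) ≤ _ at h
  linarith

theorem ext_smul_le (c : 𝕜) (z : SymTensor 𝕜 n E) : α.ext E (c • z) ≤ ‖c‖ * α.ext E z := by
  rcases eq_or_ne c 0 with rfl | hc
  · simp [ext_zero]
  have hc' : 0 < ‖c‖ := norm_pos_iff.2 hc
  rw [← inv_mul_le_iff₀ hc']
  refine α.le_ext z _ fun M _ w hw => ?_
  rw [inv_mul_le_iff₀ hc', ← hw, ← map_smul, ← map_smul_eq_mul (α.norm M)]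
  exact α.ext_le M (c • w)

/-- The normed space `⊗^{n,s}_α E`: the vector space `⊗^{n,s} E` with the norm `α`. -/
def Space (_ : FinSTensorNorm.{u} 𝕜 n) (E : Type u) [NormedAddCommGroup E] [NormedSpace 𝕜 E] :
    Type u := SymTensor 𝕜 n E

instance : AddCommGroup (α.Space E) := inferInstanceAs (AddCommGroup (SymTensor 𝕜 n E))

instance : Module 𝕜 (α.Space E) := inferInstanceAs (Module 𝕜 (SymTensor 𝕜 n E))

/-- An element of `⊗^{n,s} E`, viewed in `⊗^{n,s}_α E`. -/
def toSpace : SymTensor 𝕜 n E ≃ₗ[𝕜] α.Space E := LinearEquiv.refl 𝕜 _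

instance : NormedAddCommGroup (α.Space E) :=
  AddGroupNorm.toNormedAddCommGroup
    { toFun := fun z => α.ext E (α.toSpace.symm z)
      map_zero' := α.ext_zero
      add_le' := α.ext_add_le
      neg' := fun z => (Seminorm.ofSMulLE (𝕜 := 𝕜) (α.ext E) α.ext_zero α.ext_add_le
        α.ext_smul_le).neg' z
      eq_zero_of_map_eq_zero' := fun z hz =>
        SymTensor.eq_zero_of_injNorm (𝕜 := 𝕜) (n := n) (E := E) z
          ((α.injNorm_le_ext (α.toSpace.symm z)).trans hz.le) }

theorem norm_eq_ext (z : α.Space E) : ‖z‖ = α.ext E (α.toSpace.symm z) := rfl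

instance : NormedSpace 𝕜 (α.Space E) := ⟨fun c z => α.ext_smul_le c (α.toSpace.symm z)⟩

/-- The power `⊗ⁿ x` as an element of `⊗^{n,s}_α E`. -/
def pow (x : E) : α.Space E := α.toSpace (SymTensor.pow 𝕜 n x)

/-- The symmetric product `x₁ ∨ ⋯ ∨ xₙ` as an element of `⊗^{n,s}_α E`. -/
def symProd (x : Fin n → E) : α.Space E := α.toSpace (SymTensor.symProd x)

end FinSTensorNorm

variable (𝕜 n) in
/-- A (finitely generated) s-tensor norm of order `n` on the class of Banach spaces. -/
structure STensorNorm where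
  /-- the norm on `⊗^{n,s} E` -/
  norm : ∀ (E : Type u) [NormedAddCommGroup E] [NormedSpace 𝕜 E] [CompleteSpace E],
    Seminorm 𝕜 (SymTensor 𝕜 n E)
  eq_zero : ∀ (E : Type u) [NormedAddCommGroup E] [NormedSpace 𝕜 E] [CompleteSpace E]
    (z : SymTensor 𝕜 n E), norm E z = 0 → z = 0
  injNorm_le : ∀ (E : Type u) [NormedAddCommGroup E] [NormedSpace 𝕜 E] [CompleteSpace E]
    (z : SymTensor 𝕜 n E), z.injNorm ≤ norm E z
  le_projNorm : ∀ (E : Type u) [NormedAddCommGroup E] [NormedSpace 𝕜 E] [CompleteSpace E]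
    (z : SymTensor 𝕜 n E), norm E z ≤ z.projNorm
  map_le : ∀ (E F : Type u) [NormedAddCommGroup E] [NormedSpace 𝕜 E] [CompleteSpace E]
    [NormedAddCommGroup F] [NormedSpace 𝕜 F] [CompleteSpace F] (T : E →L[𝕜] F)
    (z : SymTensor 𝕜 n E), norm F (SymTensor.map T.toLinearMap z) ≤ ‖T‖ ^ n * norm E z
  finitelyGenerated : ∀ (E : Type u) [NormedAddCommGroup E] [NormedSpace 𝕜 E] [CompleteSpace E]
    (z : SymTensor 𝕜 n E), norm E z =
      sInf {r | ∃ (M : Submodule 𝕜 E) (_ : FiniteDimensional 𝕜 M) (w : SymTensor 𝕜 n M),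
        SymTensor.map M.subtype w = z ∧
          r = (haveI := FiniteDimensional.complete 𝕜 M; norm M w)}

namespace STensorNorm

variable (β : STensorNorm.{u} 𝕜 n)

/-- The restriction of `β` to finite-dimensional spaces. -/
def fin : FinSTensorNorm.{u} 𝕜 n where
  norm M _ _ _ := haveI := FiniteDimensional.complete 𝕜 M; β.norm M
  injNorm_le M _ _ _ z := haveI := FiniteDimensional.complete 𝕜 M; β.injNorm_le M z
  map_le M N _ _ _ _ _ _ T hT z := by
    have := FiniteDimensional.complete 𝕜 M
    have := FiniteDimensional.complete 𝕜 N
    exact (β.map_le M N T z).trans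
      (mul_le_of_le_one_left (apply_nonneg _ _) (pow_le_one₀ (norm_nonneg _) hT))

/-- On Banach spaces the norm of `⊗^{n,s}_β E` is the given one. -/
theorem norm_fin_space {E : Type u} [NormedAddCommGroup E] [NormedSpace 𝕜 E] [CompleteSpace E]
    (z : SymTensor 𝕜 n E) : ‖β.fin.toSpace z‖ = β.norm E z :=
  (β.finitelyGenerated E z).symm

theorem norm_pow_le {E : Type u} [NormedAddCommGroup E] [NormedSpace 𝕜 E] (x : E) :
    ‖β.fin.pow x‖ ≤ ‖x‖ ^ n := by
  have h := β.fin.ext_le (𝕜 ∙ x)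
    (SymTensor.pow 𝕜 n ⟨x, Submodule.mem_span_singleton_self x⟩)
  rw [SymTensor.map_pow] at h
  have := FiniteDimensional.complete 𝕜 (𝕜 ∙ x)
  exact h.trans ((β.le_projNorm (𝕜 ∙ x) _).trans (SymTensor.projNorm_pow_le _))

variable {E F : Type u} [NormedAddCommGroup E] [NormedSpace 𝕜 E]
  [NormedAddCommGroup F] [NormedSpace 𝕜 F]

theorem pairing_bound (z : SymTensor 𝕜 n E) : ∃ C, ∀ w : β.fin.Space (StrongDual 𝕜 E),
    ‖z.pairing (β.fin.toSpace.symm w)‖ ≤ C * ‖w‖ := by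
  induction z using SymTensor.induction with
  | hpow x =>
    obtain ⟨c, Φ, hΦ, hc⟩ := exists_smul_norm_le_one
      (NormedSpace.inclusionInDoubleDual 𝕜 E x)
    refine ⟨‖c‖ ^ n, fun w => ?_⟩
    have h : ∀ w : SymTensor 𝕜 n (StrongDual 𝕜 E),
        (SymTensor.pow 𝕜 n x).pairing w = c ^ n * w.pairing (SymTensor.pow 𝕜 n Φ) := by
      intro w
      have hp := SymTensor.pow_smul (𝕜 := 𝕜) (n := n) c Φ
      rw [← hc] at hp
      rw [← smul_eq_mul, ← map_smul, ← hp]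
      induction w using SymTensor.induction with
      | hpow φ => simp
      | h0 => simp
      | hadd z w hz hw => simp [hz, hw]
      | hsmul c z hz => simp [hz]
    rw [h, norm_mul, norm_pow]
    exact mul_le_mul_of_nonneg_left ((SymTensor.norm_pairing_le_injNorm _ Φ hΦ).trans
      (β.fin.injNorm_le_ext _)) (by positivity)
  | h0 => exact ⟨0, by simp⟩
  | hadd z w hz hw =>
    obtain ⟨C, hC⟩ := hz
    obtain ⟨D, hD⟩ := hw
    exact ⟨C + D, fun φ => by
      simpa [add_mul] using (norm_add_le _ _).trans (add_le_add (hC φ) (hD φ))⟩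
  | hsmul c z hz =>
    obtain ⟨C, hC⟩ := hz
    exact ⟨‖c‖ * C, fun φ => by
      simpa [mul_assoc] using mul_le_mul_of_nonneg_left (hC φ) (norm_nonneg c)⟩

/-- The functional on `⊗^{n,s}_β E'` given by an element of `⊗^{n,s} E`. -/
def dualEval : SymTensor 𝕜 n E →ₗ[𝕜] StrongDual 𝕜 (β.fin.Space (StrongDual 𝕜 E)) where
  toFun z := LinearMap.mkContinuousOfExistsBound
    (z.pairing ∘ₗ (β.fin.toSpace (E := StrongDual 𝕜 E)).symm.toLinearMap) (β.pairing_bound z)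
  map_add' _ _ := by ext; simp
  map_smul' _ _ := by ext; simp

@[simp] theorem dualEval_apply (z : SymTensor 𝕜 n E) (w : β.fin.Space (StrongDual 𝕜 E)) :
    β.dualEval z w = z.pairing (β.fin.toSpace.symm w) := rfl

/-- The dual norm `β'` on finite-dimensional spaces, determined by the isometric identity
`⊗^{n,s}_{β'} M = (⊗^{n,s}_β M')'`. On other spaces it is extended by `FinSTensorNorm.ext`. -/
def dual : FinSTensorNorm.{u} 𝕜 n where
  norm M _ _ _ := (normSeminorm 𝕜 (StrongDual 𝕜 (β.fin.Space (StrongDual 𝕜 M)))).comp β.dualEval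
  injNorm_le M _ _ _ z := by
    refine SymTensor.injNorm_le _ _ fun φ hφ => ?_
    refine ((β.dualEval z).le_opNorm (β.fin.pow φ)).trans
      (mul_le_of_le_one_right (norm_nonneg _) ?_)
    exact (β.norm_pow_le φ).trans (pow_le_one₀ (norm_nonneg _) hφ)
  map_le M N _ _ _ _ _ _ T hT z := by
    let T' : StrongDual 𝕜 N →L[𝕜] StrongDual 𝕜 M := (ContinuousLinearMap.compL 𝕜 M N 𝕜).flip T
    have hT' : ‖T'‖ ≤ 1 := T'.opNorm_le_bound zero_le_one fun φ => by
      rw [one_mul]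
      exact (φ.opNorm_comp_le T).trans (mul_le_of_le_one_right (norm_nonneg _) hT)
    refine ContinuousLinearMap.opNorm_le_bound _ (norm_nonneg (β.dualEval z)) fun w => ?_
    have h : β.dualEval (SymTensor.map T.toLinearMap z) w =
        β.dualEval z (β.fin.toSpace (SymTensor.map T'.toLinearMap (β.fin.toSpace.symm w))) := by
      rw [dualEval_apply, dualEval_apply, LinearEquiv.symm_apply_apply]
      generalize β.fin.toSpace.symm w = w
      induction w using SymTensor.induction with
      | hpow φ => rw [SymTensor.pairing_map_pow, SymTensor.map_pow]; rfl
      | h0 => simp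
      | hadd z w hz hw => simp [hz, hw]
      | hsmul c z hz => simp [hz]
    rw [h]
    exact ((β.dualEval z).le_opNorm _).trans
      (mul_le_mul_of_nonneg_left (β.fin.ext_map_le T' hT' _) (norm_nonneg _))

/-- On finite-dimensional spaces `⊗^{n,s}_{β'} M = (⊗^{n,s}_β M')'` isometrically. -/
theorem norm_dual_space {M : Type u} [NormedAddCommGroup M] [NormedSpace 𝕜 M]
    [FiniteDimensional 𝕜 M] (z : SymTensor 𝕜 n M) : ‖β.dual.toSpace z‖ = ‖β.dualEval z‖ := by
  apply le_antisymm
  · let i : M →L[𝕜] (⊤ : Submodule 𝕜 M) := (ContinuousLinearMap.id 𝕜 M).codRestrict _ (by simp)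
    have hi : ‖i‖ ≤ 1 := i.opNorm_le_bound zero_le_one fun x => by rw [one_mul]; exact le_rfl
    have e : (⊤ : Submodule 𝕜 M).subtype ∘ₗ i.toLinearMap = LinearMap.id := by ext; rfl
    have e2 : SymTensor.map LinearMap.id z = z := by
      induction z using SymTensor.induction <;> simp_all
    have h := β.dual.ext_le ⊤ (SymTensor.map i.toLinearMap z)
    rw [SymTensor.map_map, e, e2] at h
    exact h.trans (β.dual.map_le _ _ i hi z)
  · refine β.dual.le_ext z _ fun M _ w hw => ?_
    rw [← hw]
    exact β.dual.map_le _ _ M.subtypeL M.norm_subtypeL_le w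

end STensorNorm

end Norms

section TensorProducts

variable (𝕜 : Type) [RCLike 𝕜] (E F : Type u) [NormedAddCommGroup E] [NormedSpace 𝕜 E]
  [NormedAddCommGroup F] [NormedSpace 𝕜 F]

variable {𝕜 E F}

/-- The projective norm `π₂` on `E ⊗ F`. -/
def projNorm₂ (z : E ⊗[𝕜] F) : ℝ :=
  sInf {r | ∃ l : List (E × F), z = (l.map fun p => p.1 ⊗ₜ[𝕜] p.2).sum ∧
    r = (l.map fun p => ‖p.1‖ * ‖p.2‖).sum}

/-- The injective norm `ε₂` on `E ⊗ F`. -/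
def injNorm₂ (z : E ⊗[𝕜] F) : ℝ :=
  sSup {r | ∃ (φ : StrongDual 𝕜 E) (ψ : StrongDual 𝕜 F), ‖φ‖ ≤ 1 ∧ ‖ψ‖ ≤ 1 ∧
    r = ‖TensorProduct.dualDistrib 𝕜 E F (φ.toLinearMap ⊗ₜ ψ.toLinearMap) z‖}

theorem projNorm₂_nonempty (z : E ⊗[𝕜] F) :
    ∃ l : List (E × F), z = (l.map fun p => p.1 ⊗ₜ[𝕜] p.2).sum := by
  induction z using TensorProduct.induction_on with
  | zero => exact ⟨[], by simp⟩
  | tmul x y => exact ⟨[(x, y)], by simp⟩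
  | add z w hz hw =>
    obtain ⟨l, rfl⟩ := hz
    obtain ⟨l', rfl⟩ := hw
    exact ⟨l ++ l', by simp⟩

theorem list_nonneg (l : List (E × F)) : 0 ≤ (l.map fun p => ‖p.1‖ * ‖p.2‖).sum := by
  refine List.sum_nonneg fun a ha => ?_
  obtain ⟨p, _, rfl⟩ := List.mem_map.1 ha
  positivity

theorem projNorm₂_le (l : List (E × F)) :
    projNorm₂ (l.map fun p => p.1 ⊗ₜ[𝕜] p.2).sum ≤ (l.map fun p => ‖p.1‖ * ‖p.2‖).sum :=
  csInf_le ⟨0, by rintro _ ⟨l, _, rfl⟩; exact list_nonneg l⟩ ⟨l, rfl, rfl⟩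

theorem le_projNorm₂ (z : E ⊗[𝕜] F) (C : ℝ) (h : ∀ l : List (E × F),
    z = (l.map fun p => p.1 ⊗ₜ[𝕜] p.2).sum → C ≤ (l.map fun p => ‖p.1‖ * ‖p.2‖).sum) :
    C ≤ projNorm₂ z := by
  obtain ⟨l, hl⟩ := projNorm₂_nonempty z
  exact le_csInf ⟨_, l, hl, rfl⟩ (by rintro _ ⟨l, hl, rfl⟩; exact h l hl)

theorem projNorm₂_zero : projNorm₂ (0 : E ⊗[𝕜] F) = 0 :=
  le_antisymm (by simpa using projNorm₂_le (𝕜 := 𝕜) ([] : List (E × F)))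
    (le_projNorm₂ _ _ fun l _ => list_nonneg l)

theorem projNorm₂_add_le (y z : E ⊗[𝕜] F) :
    projNorm₂ (y + z) ≤ projNorm₂ y + projNorm₂ z := by
  rw [← sub_le_iff_le_add]
  refine le_projNorm₂ _ _ fun l hl => ?_
  rw [sub_le_comm]
  refine le_projNorm₂ _ _ fun l' hl' => ?_
  rw [sub_le_iff_le_add, hl, hl']
  simpa [add_comm] using projNorm₂_le (𝕜 := 𝕜) (l' ++ l)

theorem projNorm₂_smul_le (c : 𝕜) (z : E ⊗[𝕜] F) :
    projNorm₂ (c • z) ≤ ‖c‖ * projNorm₂ z := by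
  rcases eq_or_ne c 0 with rfl | hc
  · simp [projNorm₂_zero]
  have hc' : 0 < ‖c‖ := norm_pos_iff.2 hc
  rw [← inv_mul_le_iff₀ hc']
  refine le_projNorm₂ _ _ fun l hl => ?_
  rw [inv_mul_le_iff₀ hc', hl]
  have h := projNorm₂_le (𝕜 := 𝕜) (l.map fun p => (c • p.1, p.2))
  simpa [Function.comp_def, norm_smul, mul_assoc, List.sum_map_mul_left, List.smul_sum,
    TensorProduct.smul_tmul'] using h

theorem norm_dualDistrib_le_projNorm₂ (z : E ⊗[𝕜] F) (φ : StrongDual 𝕜 E) (ψ : StrongDual 𝕜 F)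
    (hφ : ‖φ‖ ≤ 1) (hψ : ‖ψ‖ ≤ 1) :
    ‖TensorProduct.dualDistrib 𝕜 E F (φ.toLinearMap ⊗ₜ ψ.toLinearMap) z‖ ≤ projNorm₂ z := by
  refine le_projNorm₂ _ _ fun l hl => ?_
  subst hl
  induction l with
  | nil => simp
  | cons p l ih =>
    simp only [List.map_cons, List.sum_cons, map_add, TensorProduct.dualDistrib_apply]
    refine (norm_add_le _ _).trans (add_le_add ?_ ih)
    rw [norm_mul]
    refine mul_le_mul ?_ ?_ (norm_nonneg _) (norm_nonneg _)
    · simpa using φ.le_of_opNorm_le hφ p.1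
    · simpa using ψ.le_of_opNorm_le hψ p.2

theorem norm_dualDistrib_le_injNorm₂ (z : E ⊗[𝕜] F) (φ : StrongDual 𝕜 E) (ψ : StrongDual 𝕜 F)
    (hφ : ‖φ‖ ≤ 1) (hψ : ‖ψ‖ ≤ 1) :
    ‖TensorProduct.dualDistrib 𝕜 E F (φ.toLinearMap ⊗ₜ ψ.toLinearMap) z‖ ≤ injNorm₂ z :=
  le_csSup ⟨projNorm₂ z, by
    rintro _ ⟨φ, ψ, hφ, hψ, rfl⟩
    exact norm_dualDistrib_le_projNorm₂ z φ ψ hφ hψ⟩ ⟨φ, ψ, hφ, hψ, rfl⟩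

theorem injNorm₂_le (z : E ⊗[𝕜] F) (C : ℝ)
    (h : ∀ (φ : StrongDual 𝕜 E) (ψ : StrongDual 𝕜 F), ‖φ‖ ≤ 1 → ‖ψ‖ ≤ 1 →
      ‖TensorProduct.dualDistrib 𝕜 E F (φ.toLinearMap ⊗ₜ ψ.toLinearMap) z‖ ≤ C) :
    injNorm₂ z ≤ C :=
  csSup_le ⟨_, 0, 0, by simp, by simp, rfl⟩
    (by rintro _ ⟨φ, ψ, hφ, hψ, rfl⟩; exact h φ ψ hφ hψ)

theorem injNorm₂_le_projNorm₂ (z : E ⊗[𝕜] F) : injNorm₂ z ≤ projNorm₂ z :=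
  injNorm₂_le z _ (norm_dualDistrib_le_projNorm₂ z)

theorem injNorm₂_nonneg (z : E ⊗[𝕜] F) : 0 ≤ injNorm₂ z :=
  (norm_nonneg _).trans (norm_dualDistrib_le_injNorm₂ z 0 0 (by simp) (by simp))

theorem injNorm₂_zero : injNorm₂ (0 : E ⊗[𝕜] F) = 0 :=
  le_antisymm (injNorm₂_le _ _ (by simp)) (injNorm₂_nonneg _)

theorem injNorm₂_add_le (y z : E ⊗[𝕜] F) : injNorm₂ (y + z) ≤ injNorm₂ y + injNorm₂ z := by
  refine injNorm₂_le _ _ fun φ ψ hφ hψ => ?_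
  rw [map_add]
  exact (norm_add_le _ _).trans (add_le_add (norm_dualDistrib_le_injNorm₂ y φ ψ hφ hψ)
    (norm_dualDistrib_le_injNorm₂ z φ ψ hφ hψ))

theorem injNorm₂_smul_le (c : 𝕜) (z : E ⊗[𝕜] F) : injNorm₂ (c • z) ≤ ‖c‖ * injNorm₂ z := by
  refine injNorm₂_le _ _ fun φ ψ hφ hψ => ?_
  rw [map_smul, norm_smul]
  exact mul_le_mul_of_nonneg_left (norm_dualDistrib_le_injNorm₂ z φ ψ hφ hψ) (norm_nonneg c)

theorem eq_zero_of_injNorm₂ (z : E ⊗[𝕜] F) (h : injNorm₂ z ≤ 0) : z = 0 := by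
  have h0 : ∀ (φ : StrongDual 𝕜 E) (ψ : StrongDual 𝕜 F),
      TensorProduct.dualDistrib 𝕜 E F (φ.toLinearMap ⊗ₜ ψ.toLinearMap) z = 0 := by
    intro φ ψ
    obtain ⟨c, φ', hφ', rfl⟩ := exists_smul_norm_le_one φ
    obtain ⟨d, ψ', hψ', rfl⟩ := exists_smul_norm_le_one ψ
    have := (norm_dualDistrib_le_injNorm₂ z φ' ψ' hφ' hψ').trans h
    rw [norm_le_zero_iff] at this
    have e : (c • φ').toLinearMap ⊗ₜ[𝕜] (d • ψ').toLinearMap =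
      (c * d) • (φ'.toLinearMap ⊗ₜ[𝕜] ψ'.toLinearMap) := by
      rw [ContinuousLinearMap.toLinearMap_smul, ContinuousLinearMap.toLinearMap_smul,
        TensorProduct.smul_tmul_smul]
    rw [e, map_smul, LinearMap.smul_apply, this, smul_zero]
  obtain ⟨m, rfl⟩ := TensorProduct.eq_repr_basis_right (Module.Basis.ofVectorSpace 𝕜 F) z
  have h1 : ∀ φ : StrongDual 𝕜 E,
      m.sum (fun i x => φ x • Module.Basis.ofVectorSpace 𝕜 F i) = 0 := by
    intro φ
    refine (SeparatingDual.eq_zero_iff_forall_dual_eq_zero (R := 𝕜) _).2 fun ψ => ?_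
    rw [← h0 φ ψ]
    simp [Finsupp.sum]
  have h2 : m = 0 := by
    ext i
    refine (SeparatingDual.eq_zero_iff_forall_dual_eq_zero (R := 𝕜) _).2 fun φ => ?_
    have h3 := linearIndependent_iff.1 (Module.Basis.ofVectorSpace 𝕜 F).linearIndependent
      (m.mapRange φ (map_zero φ)) (by
        rw [Finsupp.linearCombination_apply, Finsupp.sum_mapRange_index (by simp)]
        exact h1 φ)
    simpa using DFunLike.congr_fun h3 i
  simp [h2]

variable (𝕜 E F) in
/-- The normed space `E ⊗_{π₂} F`: the algebraic tensor product with the projective norm. -/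
def ProjTensor : Type u := E ⊗[𝕜] F

variable (𝕜 E F) in
/-- The normed space `E ⊗_{ε₂} F`: the algebraic tensor product with the injective norm. -/
def InjTensor : Type u := E ⊗[𝕜] F

namespace ProjTensor

instance : AddCommGroup (ProjTensor 𝕜 E F) := inferInstanceAs (AddCommGroup (E ⊗[𝕜] F))

instance : Module 𝕜 (ProjTensor 𝕜 E F) := inferInstanceAs (Module 𝕜 (E ⊗[𝕜] F))

variable (𝕜 E F) in
/-- An element of `E ⊗ F`, viewed in `E ⊗_{π₂} F`. -/
def of : E ⊗[𝕜] F ≃ₗ[𝕜] ProjTensor 𝕜 E F := LinearEquiv.refl 𝕜 _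

instance : NormedAddCommGroup (ProjTensor 𝕜 E F) :=
  AddGroupNorm.toNormedAddCommGroup
    { toFun := fun z => projNorm₂ ((of 𝕜 E F).symm z)
      map_zero' := projNorm₂_zero
      add_le' := projNorm₂_add_le
      neg' := fun z => (Seminorm.ofSMulLE (𝕜 := 𝕜) (projNorm₂ (E := E) (F := F)) projNorm₂_zero
        projNorm₂_add_le projNorm₂_smul_le).neg' z
      eq_zero_of_map_eq_zero' := fun z hz => eq_zero_of_injNorm₂ (𝕜 := 𝕜) (E := E) (F := F) z
        ((injNorm₂_le_projNorm₂ ((of 𝕜 E F).symm z)).trans hz.le) }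

theorem norm_eq (z : ProjTensor 𝕜 E F) : ‖z‖ = projNorm₂ ((of 𝕜 E F).symm z) := rfl

instance : NormedSpace 𝕜 (ProjTensor 𝕜 E F) :=
  ⟨fun c z => projNorm₂_smul_le c ((of 𝕜 E F).symm z)⟩

variable (𝕜) in
/-- The elementary tensor `x ⊗ y` in `E ⊗_{π₂} F`. -/
def tmul (x : E) (y : F) : ProjTensor 𝕜 E F := of 𝕜 E F (x ⊗ₜ y)

/-- The continuous linear map `E ⊗_{π₂} F → G` induced by a continuous bilinear map. -/
def lift {G : Type u} [NormedAddCommGroup G] [NormedSpace 𝕜 G] (B : E →L[𝕜] F →L[𝕜] G) :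
    ProjTensor 𝕜 E F →L[𝕜] G :=
  LinearMap.mkContinuous
    (TensorProduct.lift (ContinuousLinearMap.toLinearMap₁₂ B) ∘ₗ (of 𝕜 E F).symm.toLinearMap)
    ‖B‖ fun z => by
      rcases (norm_nonneg B).eq_or_lt with hB | hB
      · rw [← hB, zero_mul, norm_le_zero_iff, LinearMap.comp_apply]
        change TensorProduct.lift _ ((of 𝕜 E F).symm z) = 0
        induction (of 𝕜 E F).symm z using TensorProduct.induction_on with
        | zero => simp
        | tmul x y => simpa [← hB] using B.le_opNorm₂ x y
        | add x y hx hy => rw [map_add, hx, hy, add_zero]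
      · rw [norm_eq, ← inv_mul_le_iff₀ hB]
        refine le_projNorm₂ _ _ fun l hl => ?_
        rw [inv_mul_le_iff₀ hB, LinearMap.comp_apply]
        change ‖TensorProduct.lift _ ((of 𝕜 E F).symm z)‖ ≤ _
        rw [hl]
        clear hl
        induction l with
        | nil => simp
        | cons p l ih =>
          simp only [List.map_cons, List.sum_cons, map_add, mul_add]
          refine (norm_add_le _ _).trans (add_le_add ?_ ih)
          simpa [mul_assoc] using B.le_opNorm₂ p.1 p.2

@[simp] theorem lift_tmul {G : Type u} [NormedAddCommGroup G] [NormedSpace 𝕜 G]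
    (B : E →L[𝕜] F →L[𝕜] G) (x : E) (y : F) : lift B (tmul 𝕜 x y) = B x y := by
  simp [lift, tmul]

end ProjTensor

namespace InjTensor

instance : AddCommGroup (InjTensor 𝕜 E F) := inferInstanceAs (AddCommGroup (E ⊗[𝕜] F))

instance : Module 𝕜 (InjTensor 𝕜 E F) := inferInstanceAs (Module 𝕜 (E ⊗[𝕜] F))

variable (𝕜 E F) in
/-- An element of `E ⊗ F`, viewed in `E ⊗_{ε₂} F`. -/
def of : E ⊗[𝕜] F ≃ₗ[𝕜] InjTensor 𝕜 E F := LinearEquiv.refl 𝕜 _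

instance : NormedAddCommGroup (InjTensor 𝕜 E F) :=
  AddGroupNorm.toNormedAddCommGroup
    { toFun := fun z => injNorm₂ ((of 𝕜 E F).symm z)
      map_zero' := injNorm₂_zero
      add_le' := injNorm₂_add_le
      neg' := fun z => (Seminorm.ofSMulLE (𝕜 := 𝕜) (injNorm₂ (E := E) (F := F)) injNorm₂_zero
        injNorm₂_add_le injNorm₂_smul_le).neg' z
      eq_zero_of_map_eq_zero' := fun z hz =>
        eq_zero_of_injNorm₂ (𝕜 := 𝕜) (E := E) (F := F) z hz.le }

theorem norm_eq (z : InjTensor 𝕜 E F) : ‖z‖ = injNorm₂ ((of 𝕜 E F).symm z) := rfl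

instance : NormedSpace 𝕜 (InjTensor 𝕜 E F) :=
  ⟨fun c z => injNorm₂_smul_le c ((of 𝕜 E F).symm z)⟩

variable (𝕜) in
/-- The elementary tensor `x ⊗ y` in `E ⊗_{ε₂} F`. -/
def tmul (x : E) (y : F) : InjTensor 𝕜 E F := of 𝕜 E F (x ⊗ₜ y)

end InjTensor

end TensorProducts

section Conditions

variable {𝕜 : Type} [RCLike 𝕜] {n : ℕ}

/-- Associativity of a continuous bilinear multiplication. A Banach space with such a multiplication
is a Banach algebra (a unit is not required, and the multiplication need not be contractive). -/
def IsAssocMul {A : Type u} [NormedAddCommGroup A] [NormedSpace 𝕜 A] (m : A →L[𝕜] A →L[𝕜] A) :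
    Prop := ∀ a b c, m (m a b) c = m a (m b c)

namespace STensorNorm

variable (β : STensorNorm.{u} 𝕜 n)

/-- The completed symmetric tensor product of `E` with respect to `β`. -/
abbrev ComplSpace (E : Type u) [NormedAddCommGroup E] [NormedSpace 𝕜 E] : Type u :=
  UniformSpace.Completion (β.fin.Space E)

section Maps

variable {E F : Type u} [NormedAddCommGroup E] [NormedSpace 𝕜 E]
  [NormedAddCommGroup F] [NormedSpace 𝕜 F]

/-- `M` is the natural multiplication on the completion of `⊗^{n,s}_β A`, where `A` has the
multiplication `m`: it is the continuous bilinear map with `(⊗ⁿ a)(⊗ⁿ b) = ⊗ⁿ (ab)`. -/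
def IsNaturalMul (m : E →L[𝕜] E →L[𝕜] E)
    (M : β.ComplSpace E →L[𝕜] β.ComplSpace E →L[𝕜] β.ComplSpace E) : Prop :=
  ∀ a b : E, M (β.fin.pow a : β.fin.Space E) (β.fin.pow b : β.fin.Space E) =
    (β.fin.pow (m a b) : β.fin.Space E)

/-- `f` is the natural map with `f((⊗ⁿ x) ⊗ (⊗ⁿ y)) = ⊗ⁿ (x ⊗ y)`. -/
def IsNaturalF (f : ProjTensor 𝕜 (β.fin.Space E) (β.fin.Space F) →L[𝕜]
    β.fin.Space (ProjTensor 𝕜 E F)) : Prop :=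
  ∀ (x : E) (y : F), f (ProjTensor.tmul 𝕜 (β.fin.pow x) (β.fin.pow y)) =
    β.fin.pow (ProjTensor.tmul 𝕜 x y)

/-- `g` is the natural map with `g(⊗ⁿ (x ⊗ y)) = (⊗ⁿ x) ⊗ (⊗ⁿ y)`. The powers of elementary
tensors do not span `⊗^{n,s} (E ⊗ F)`, so the formula is required in its polarized form, which
determines `g`; the unpolarized one is the case of constant families `x` and `y`. -/
def IsNaturalG (g : β.dual.Space (InjTensor 𝕜 E F) →L[𝕜]
    InjTensor 𝕜 (β.dual.Space E) (β.dual.Space F)) : Prop :=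
  ∀ (x : Fin n → E) (y : Fin n → F),
    g (β.dual.symProd fun i => InjTensor.tmul 𝕜 (x i) (y i)) =
      InjTensor.tmul 𝕜 (β.dual.symProd x) (β.dual.symProd y)

/-- `h` is the natural map with `h(⊗ⁿ T)(⊗ⁿ x) = ⊗ⁿ (T x)`. -/
def IsNaturalH (h : β.dual.Space (E →L[𝕜] F) →L[𝕜] (β.fin.Space E →L[𝕜] β.dual.Space F)) : Prop :=
  ∀ (T : E →L[𝕜] F) (x : E), h (β.dual.pow T) (β.fin.pow x) = β.dual.pow (T x)

end Maps

/-- `β` preserves Banach algebras: for every Banach algebra `A`, the completion of `⊗^{n,s}_β A` is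
a Banach algebra with the natural multiplication. -/
def PreservesBanachAlgebras : Prop :=
  ∀ (A : Type u) [NormedAddCommGroup A] [NormedSpace 𝕜 A] [CompleteSpace A]
    (m : A →L[𝕜] A →L[𝕜] A), IsAssocMul m →
    ∃ M : β.ComplSpace A →L[𝕜] β.ComplSpace A →L[𝕜] β.ComplSpace A,
      IsAssocMul M ∧ β.IsNaturalMul m M

/-- For all Banach spaces the natural continuous map
`f : (⊗^{n,s}_β E) ⊗_{π₂} (⊗^{n,s}_β F) → ⊗^{n,s}_β (E ⊗_{π₂} F)` exists. -/
def HasNaturalF : Prop :=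
  ∀ (E F : Type u) [NormedAddCommGroup E] [NormedSpace 𝕜 E] [CompleteSpace E]
    [NormedAddCommGroup F] [NormedSpace 𝕜 F] [CompleteSpace F],
    ∃ f : ProjTensor 𝕜 (β.fin.Space E) (β.fin.Space F) →L[𝕜] β.fin.Space (ProjTensor 𝕜 E F),
      β.IsNaturalF f

/-- For all Banach spaces the natural continuous map
`g : ⊗^{n,s}_{β'} (E ⊗_{ε₂} F) → (⊗^{n,s}_{β'} E) ⊗_{ε₂} (⊗^{n,s}_{β'} F)` exists. -/
def HasNaturalG : Prop :=
  ∀ (E F : Type u) [NormedAddCommGroup E] [NormedSpace 𝕜 E] [CompleteSpace E]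
    [NormedAddCommGroup F] [NormedSpace 𝕜 F] [CompleteSpace F],
    ∃ g : β.dual.Space (InjTensor 𝕜 E F) →L[𝕜] InjTensor 𝕜 (β.dual.Space E) (β.dual.Space F),
      β.IsNaturalG g

/-- For all Banach spaces the natural continuous map
`h : ⊗^{n,s}_{β'} L(E, F) → L(⊗^{n,s}_β E, ⊗^{n,s}_{β'} F)` exists. -/
def HasNaturalH : Prop :=
  ∀ (E F : Type u) [NormedAddCommGroup E] [NormedSpace 𝕜 E] [CompleteSpace E]
    [NormedAddCommGroup F] [NormedSpace 𝕜 F] [CompleteSpace F],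
    ∃ h : β.dual.Space (E →L[𝕜] F) →L[𝕜] (β.fin.Space E →L[𝕜] β.dual.Space F), β.IsNaturalH h

/-- The constants `c` with `‖m(⊗^{n,s}_β A)‖ ≤ c ‖m(A)‖ⁿ` (completed tensor product) for every
Banach algebra `A`, where `m(A) : A ⊗_{π₂} A → A` is induced by the multiplication. -/
def algebraConstants : Set ℝ :=
  {c | ∀ (A : Type u) [NormedAddCommGroup A] [NormedSpace 𝕜 A] [CompleteSpace A]
    (m : A →L[𝕜] A →L[𝕜] A), IsAssocMul m →
    ∃ M : β.ComplSpace A →L[𝕜] β.ComplSpace A →L[𝕜] β.ComplSpace A,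
      IsAssocMul M ∧ β.IsNaturalMul m M ∧ ‖ProjTensor.lift M‖ ≤ c * ‖ProjTensor.lift m‖ ^ n}

/-- The constants `c` with `‖f‖ ≤ c` for all Banach spaces `E` and `F`. -/
def fConstants : Set ℝ :=
  {c | ∀ (E F : Type u) [NormedAddCommGroup E] [NormedSpace 𝕜 E] [CompleteSpace E]
    [NormedAddCommGroup F] [NormedSpace 𝕜 F] [CompleteSpace F],
    ∃ f : ProjTensor 𝕜 (β.fin.Space E) (β.fin.Space F) →L[𝕜] β.fin.Space (ProjTensor 𝕜 E F),
      β.IsNaturalF f ∧ ‖f‖ ≤ c}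

/-- The constants `c` with `‖g‖ ≤ c` for all Banach spaces `E` and `F`. -/
def gConstants : Set ℝ :=
  {c | ∀ (E F : Type u) [NormedAddCommGroup E] [NormedSpace 𝕜 E] [CompleteSpace E]
    [NormedAddCommGroup F] [NormedSpace 𝕜 F] [CompleteSpace F],
    ∃ g : β.dual.Space (InjTensor 𝕜 E F) →L[𝕜] InjTensor 𝕜 (β.dual.Space E) (β.dual.Space F),
      β.IsNaturalG g ∧ ‖g‖ ≤ c}

/-- The constants `c` with `‖h‖ ≤ c` for all Banach spaces `E` and `F`. -/
def hConstants : Set ℝ :=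
  {c | ∀ (E F : Type u) [NormedAddCommGroup E] [NormedSpace 𝕜 E] [CompleteSpace E]
    [NormedAddCommGroup F] [NormedSpace 𝕜 F] [CompleteSpace F],
    ∃ h : β.dual.Space (E →L[𝕜] F) →L[𝕜] (β.fin.Space E →L[𝕜] β.dual.Space F),
      β.IsNaturalH h ∧ ‖h‖ ≤ c}

end STensorNorm

end Conditions

end BanachTensor

end

/-!
All four conditions say that the maps
`B_n : ⊗^{n,s}_β E × ⊗^{n,s}_β F → ⊗^{n,s}_β G`, `(⊗ⁿ x, ⊗ⁿ y) ↦ ⊗ⁿ B(x, y)`, induced by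
contractive bilinear maps `B : E × F → G` have uniformly bounded norms. This is the property
`STensorNorm.MapBound c`, with `c` the bound, and each of the four sets of constants equals
`{c | β.MapBound c}`. A least element of this set exists because the set is defined by non-strict
inequalities.

*Reduction to finite dimensions.* Since `β` and `β'` are finitely generated, all estimates reduce to
finite-dimensional spaces; for `β` the bound for the universal bilinear map `M × N → M ⊗_{π₂} N` is
enough (`mapBound_of_finiteDimensional`).

*Uniformity.* Each condition provides a constant for every single pair of spaces. The estimates pass
to contractive retracts, so that a sequence of pairs without common constant could be collected into
one bad pair of `ℓ_∞`-sums (`exists_uniform_of_retract`).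

*Algebras.* A bilinear map `B : E × F → G` gives the associative multiplication
`(x, y, v)(x', y', v') = (0, 0, B(x, y'))` on `E × F × G` (`triMul`), and the natural multiplication
on the symmetric tensor product of this algebra contains `B_n`. Conversely `B_n` for the
multiplication `B` of an algebra extends to the completion.

*Duality.* For finite-dimensional `M` the bracket between `⊗^{n,s} M` and `⊗^{n,s} M'` is perfect,
and `β'' = β` by the Hahn–Banach theorem (`fin_ext_le`). For operators, `h` on `L(M, N')` is the
transpose of the universal bilinear map, since `L(M, N') = (M ⊗_{π₂} N)'`; in the same way `g` on
`M' ⊗_{ε₂} N' = (M ⊗_{π₂} N)'` is the transpose of `f` (`dualDistrib_split_pairing`,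
`pairing_map₂_tmulL`). Only one contraction is needed for each direction, and infinite-dimensional
`E ⊗_{ε₂} F` are reached because the injective norm respects subspaces.
-/

noncomputable section

namespace BanachTensor

set_option maxSynthPendingDepth 3

/-! ### Bilinear maps, symmetrization and the splitting of tensors of tensors -/

namespace SymTensor

variable {𝕜 : Type} [RCLike 𝕜] {n : ℕ}

section Algebra

variable {E F G H : Type u} [AddCommGroup E] [Module 𝕜 E] [AddCommGroup F] [Module 𝕜 F]
  [AddCommGroup G] [Module 𝕜 G] [AddCommGroup H] [Module 𝕜 H]

/-- Two linear maps on `⊗^{n,s} E` that agree on all powers are equal. -/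
theorem hom_ext {W : Type*} [AddCommGroup W] [Module 𝕜 W] {f g : SymTensor 𝕜 n E →ₗ[𝕜] W}
    (h : ∀ x, f (pow 𝕜 n x) = g (pow 𝕜 n x)) : f = g := by
  ext z
  induction z using SymTensor.induction with
  | hpow x => exact h x
  | h0 => simp
  | hadd z w hz hw => simp [hz, hw]
  | hsmul c z hz => simp [hz]

/-- Two bilinear maps on symmetric tensors that agree on all pairs of powers are equal. -/
theorem hom_ext₂ {W : Type*} [AddCommGroup W] [Module 𝕜 W]
    {f g : SymTensor 𝕜 n E →ₗ[𝕜] SymTensor 𝕜 n F →ₗ[𝕜] W}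
    (h : ∀ x y, f (pow 𝕜 n x) (pow 𝕜 n y) = g (pow 𝕜 n x) (pow 𝕜 n y)) : f = g :=
  hom_ext fun x => hom_ext fun y => h x y

theorem map₂_mem (B : E →ₗ[𝕜] F →ₗ[𝕜] G) (z : SymTensor 𝕜 n E) (w : SymTensor 𝕜 n F) :
    PiTensorProduct.map₂ (fun _ : Fin n => B) (incl 𝕜 n E z) (incl 𝕜 n F w) ∈
      symSubmodule 𝕜 n G := by
  induction z using SymTensor.induction with
  | hpow x =>
    induction w using SymTensor.induction with
    | hpow y =>
      rw [incl_pow, incl_pow, PiTensorProduct.map₂_tprod_tprod]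
      exact Submodule.subset_span ⟨B x y, rfl⟩
    | h0 => simp
    | hadd z w hz hw => rw [map_add, map_add]; exact add_mem hz hw
    | hsmul c z hz => rw [map_smul, map_smul]; exact Submodule.smul_mem _ _ hz
  | h0 => simp
  | hadd z w hz hw => rw [map_add, map_add]; exact add_mem hz hw
  | hsmul c z hz => rw [map_smul, map_smul]; exact Submodule.smul_mem _ _ hz

/-- The bilinear map `⊗^{n,s} E × ⊗^{n,s} F → ⊗^{n,s} G` induced by a bilinear map
`B : E × F → G`; it satisfies `(⊗ⁿ x, ⊗ⁿ y) ↦ ⊗ⁿ B(x, y)`. -/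
def map₂ (B : E →ₗ[𝕜] F →ₗ[𝕜] G) :
    SymTensor 𝕜 n E →ₗ[𝕜] SymTensor 𝕜 n F →ₗ[𝕜] SymTensor 𝕜 n G :=
  LinearMap.mk₂ 𝕜 (fun z w => ⟨PiTensorProduct.map₂ (fun _ : Fin n => B) (incl 𝕜 n E z)
      (incl 𝕜 n F w), map₂_mem B z w⟩)
    (fun _ _ _ => Subtype.ext (by simp only [map_add, LinearMap.add_apply]; rfl))
    (fun _ _ _ => Subtype.ext (by simp only [map_smul, LinearMap.smul_apply]; rfl))
    (fun _ _ _ => Subtype.ext (by simp only [map_add]; rfl))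
    (fun _ _ _ => Subtype.ext (by simp only [map_smul]; rfl))

@[simp] theorem map₂_pow_pow (B : E →ₗ[𝕜] F →ₗ[𝕜] G) (x : E) (y : F) :
    map₂ B (pow 𝕜 n x) (pow 𝕜 n y) = pow 𝕜 n (B x y) := by
  apply incl_injective
  exact PiTensorProduct.map₂_tprod_tprod _ _ _

theorem map₂_smul (c : 𝕜) (B : E →ₗ[𝕜] F →ₗ[𝕜] G) :
    map₂ (n := n) (c • B) = c ^ n • map₂ B :=
  hom_ext₂ fun x y => by simp [pow_smul]

theorem map_id (z : SymTensor 𝕜 n E) : map LinearMap.id z = z :=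
  LinearMap.congr_fun (hom_ext (f := map LinearMap.id) (g := LinearMap.id) fun x => by simp) z

/-- `map₂` is natural: a commutative square of bilinear maps induces a commutative square. -/
theorem map_map₂_eq {E' F' G' : Type u} [AddCommGroup E'] [Module 𝕜 E'] [AddCommGroup F']
    [Module 𝕜 F'] [AddCommGroup G'] [Module 𝕜 G'] {B : E →ₗ[𝕜] F →ₗ[𝕜] G}
    {B' : E' →ₗ[𝕜] F' →ₗ[𝕜] G'} (S : E →ₗ[𝕜] E') (T : F →ₗ[𝕜] F') (R : G →ₗ[𝕜] G')
    (h : ∀ x y, R (B x y) = B' (S x) (T y)) (z : SymTensor 𝕜 n E) (w : SymTensor 𝕜 n F) :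
    map R (map₂ B z w) = map₂ B' (map S z) (map T w) := by
  have : (map₂ (n := n) B).compr₂ (map R) = (map₂ B').compl₁₂ (map S) (map T) :=
    hom_ext₂ fun x y => by simp [h]
  exact LinearMap.congr_fun₂ this z w

variable (𝕜 n E) in
/-- The symmetrization `⨂ⁿ E → ⊗^{n,s} E`, a left inverse of the inclusion. -/
def symmetrize : (⨂[𝕜] _ : Fin n, E) →ₗ[𝕜] SymTensor 𝕜 n E :=
  LinearMap.codRestrict (symSubmodule 𝕜 n E)
    ((n.factorial : 𝕜)⁻¹ • ∑ σ : Equiv.Perm (Fin n),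
      (PiTensorProduct.reindex 𝕜 (fun _ : Fin n => E) σ).toLinearMap) fun t => by
    induction t using PiTensorProduct.induction_on with
    | smul_tprod r x =>
      rw [map_smul]
      refine Submodule.smul_mem _ _ ?_
      convert (symProd (𝕜 := 𝕜) x).2
      simp only [LinearMap.smul_apply, LinearMap.sum_apply, LinearEquiv.coe_coe]
      change _ = incl 𝕜 n E (symProd x)
      rw [incl_symProd]
      congr 1
      refine Fintype.sum_equiv (Equiv.inv _) _ _ fun σ => ?_
      exact PiTensorProduct.reindex_tprod σ x
    | add x y hx hy => rw [map_add]; exact add_mem hx hy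

@[simp] theorem symmetrize_tprod (x : Fin n → E) :
    symmetrize 𝕜 n E (PiTensorProduct.tprod 𝕜 x) = symProd x := by
  apply incl_injective
  rw [incl_symProd]
  change ((n.factorial : 𝕜)⁻¹ • ∑ σ : Equiv.Perm (Fin n),
      (PiTensorProduct.reindex 𝕜 (fun _ : Fin n => E) σ).toLinearMap) _ = _
  simp only [LinearMap.smul_apply, LinearMap.sum_apply, LinearEquiv.coe_coe]
  congr 1
  refine Fintype.sum_equiv (Equiv.inv _) _ _ fun σ => ?_
  exact PiTensorProduct.reindex_tprod σ x

@[simp] theorem symmetrize_incl (z : SymTensor 𝕜 n E) : symmetrize 𝕜 n E (incl 𝕜 n E z) = z :=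
  LinearMap.congr_fun (hom_ext (f := symmetrize 𝕜 n E ∘ₗ incl 𝕜 n E) (g := LinearMap.id)
    fun x => by simp) z

theorem map_symProd (T : E →ₗ[𝕜] F) (x : Fin n → E) :
    map T (symProd (𝕜 := 𝕜) x) = symProd fun i => T (x i) := by
  apply incl_injective
  rw [incl_map, incl_symProd, incl_symProd]
  simp

theorem symProd_perm (x : Fin n → E) (σ : Equiv.Perm (Fin n)) :
    symProd (𝕜 := 𝕜) (fun i => x (σ i)) = symProd x := by
  apply incl_injective
  rw [incl_symProd, incl_symProd]
  congr 1
  exact Fintype.sum_equiv (Equiv.mulLeft σ) _ _ fun τ => rfl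

section Split

variable (𝕜 E) in
/-- Prepending a vector to a tensor, `x, x₁ ⊗ ⋯ ⊗ xₘ ↦ x ⊗ x₁ ⊗ ⋯ ⊗ xₘ`. -/
def tensorCons (m : ℕ) :
    E →ₗ[𝕜] (⨂[𝕜] _ : Fin m, E) →ₗ[𝕜] ⨂[𝕜] _ : Fin (m + 1), E :=
  (PiTensorProduct.lift (R := 𝕜) (s := fun _ : Fin m => E)).toLinearMap ∘ₗ
    (PiTensorProduct.tprod 𝕜 (s := fun _ : Fin (m + 1) => E)).curryLeft

theorem tensorCons_tprod {m : ℕ} (x : E) (y : Fin m → E) :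
    tensorCons 𝕜 E m x (PiTensorProduct.tprod 𝕜 y) =
      PiTensorProduct.tprod 𝕜 (Fin.cons x y : Fin (m + 1) → E) := by
  simp [tensorCons]

variable (𝕜 E F) in
/-- The multilinear map underlying `splitTensor`, built one factor at a time. -/
def splitMultilinear : (m : ℕ) → MultilinearMap 𝕜 (fun _ : Fin m => E ⊗[𝕜] F)
    ((⨂[𝕜] _ : Fin m, E) ⊗[𝕜] (⨂[𝕜] _ : Fin m, F))
  | 0 => MultilinearMap.constOfIsEmpty 𝕜 _
      (PiTensorProduct.tprod 𝕜 Fin.elim0 ⊗ₜ PiTensorProduct.tprod 𝕜 Fin.elim0)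
  | m + 1 => LinearMap.uncurryLeft
      { toFun := fun t => (TensorProduct.homTensorHomMap (.id 𝕜) _ _ _ _
          (TensorProduct.map (tensorCons 𝕜 E m) (tensorCons 𝕜 F m) t)).compMultilinearMap
            (splitMultilinear m)
        map_add' := fun s t => by ext; simp
        map_smul' := fun c t => by ext; simp }

theorem splitMultilinear_tmul {m : ℕ} (x : Fin m → E) (y : Fin m → F) :
    splitMultilinear 𝕜 E F m (fun i => x i ⊗ₜ y i) =
      PiTensorProduct.tprod 𝕜 x ⊗ₜ PiTensorProduct.tprod 𝕜 y := by
  induction m with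
  | zero =>
    rw [Subsingleton.elim x Fin.elim0, Subsingleton.elim y Fin.elim0]
    rfl
  | succ m ih =>
    change TensorProduct.homTensorHomMap (.id 𝕜) _ _ _ _
      (TensorProduct.map (tensorCons 𝕜 E m) (tensorCons 𝕜 F m) (x 0 ⊗ₜ y 0))
        (splitMultilinear 𝕜 E F m (fun i => x i.succ ⊗ₜ y i.succ)) = _
    rw [ih (fun i => x i.succ) (fun i => y i.succ)]
    simp only [TensorProduct.map_tmul, TensorProduct.homTensorHomMap_apply, tensorCons_tprod]
    congr 2 <;> exact Fin.cons_self_tail _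

variable (𝕜 n E F) in
/-- The rearrangement `⨂ⁿ (E ⊗ F) → (⨂ⁿ E) ⊗ (⨂ⁿ F)`. -/
def splitTensor : (⨂[𝕜] _ : Fin n, E ⊗[𝕜] F) →ₗ[𝕜]
    (⨂[𝕜] _ : Fin n, E) ⊗[𝕜] (⨂[𝕜] _ : Fin n, F) :=
  PiTensorProduct.lift (splitMultilinear 𝕜 E F n)

theorem splitTensor_tprod (x : Fin n → E) (y : Fin n → F) :
    splitTensor 𝕜 n E F (PiTensorProduct.tprod 𝕜 fun i => x i ⊗ₜ y i) =
      PiTensorProduct.tprod 𝕜 x ⊗ₜ PiTensorProduct.tprod 𝕜 y := by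
  rw [splitTensor, PiTensorProduct.lift.tprod, splitMultilinear_tmul]

/-- Linear maps on `⨂ⁿ (E ⊗ F)` are determined by their values on tensors of elementary tensors. -/
theorem tensor_tmul_ext {W : Type*} [AddCommGroup W] [Module 𝕜 W]
    {f g : (⨂[𝕜] _ : Fin n, E ⊗[𝕜] F) →ₗ[𝕜] W}
    (h : ∀ (x : Fin n → E) (y : Fin n → F),
      f (PiTensorProduct.tprod 𝕜 fun i => x i ⊗ₜ y i) =
        g (PiTensorProduct.tprod 𝕜 fun i => x i ⊗ₜ y i)) : f = g := by
  have hs : ∀ _ : Fin n, Submodule.span 𝕜 (Set.range fun p : E × F => p.1 ⊗ₜ[𝕜] p.2) = ⊤ := by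
    intro _
    rw [← TensorProduct.span_tmul_eq_top]
    congr 1
    ext t
    simp
  refine LinearMap.ext_on (PiTensorProduct.submodule_span_eq_top hs) ?_
  rintro _ ⟨p, rfl⟩
  exact h (fun i => (p i).1) (fun i => (p i).2)

variable (𝕜 n E F) in
/-- The natural map `⊗^{n,s} (E ⊗ F) → (⊗^{n,s} E) ⊗ (⊗^{n,s} F)`: rearrange, then symmetrize both
factors. -/
def split : SymTensor 𝕜 n (E ⊗[𝕜] F) →ₗ[𝕜] SymTensor 𝕜 n E ⊗[𝕜] SymTensor 𝕜 n F :=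
  TensorProduct.map (symmetrize 𝕜 n E) (symmetrize 𝕜 n F) ∘ₗ splitTensor 𝕜 n E F ∘ₗ
    incl 𝕜 n (E ⊗[𝕜] F)

theorem split_symProd (x : Fin n → E) (y : Fin n → F) :
    split 𝕜 n E F (symProd fun i => x i ⊗ₜ y i) = symProd x ⊗ₜ symProd y := by
  have : (n.factorial : 𝕜) ≠ 0 := by exact_mod_cast n.factorial_ne_zero
  simp only [split, LinearMap.comp_apply, incl_symProd, map_smul, map_sum]
  have h : ∀ σ : Equiv.Perm (Fin n), TensorProduct.map (symmetrize 𝕜 n E) (symmetrize 𝕜 n F)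
      (splitTensor 𝕜 n E F (PiTensorProduct.tprod 𝕜 fun i => x (σ i) ⊗ₜ y (σ i))) =
      symProd x ⊗ₜ symProd y := fun σ => by
    rw [splitTensor_tprod (fun i => x (σ i)) (fun i => y (σ i)), TensorProduct.map_tmul,
      symmetrize_tprod, symmetrize_tprod, symProd_perm, symProd_perm]
  simp only [h]
  rw [Finset.sum_const, Finset.card_univ, Fintype.card_perm, Fintype.card_fin,
    ← Nat.cast_smul_eq_nsmul 𝕜, smul_smul, inv_mul_cancel₀ this, one_smul]

/-- Linear maps on `⊗^{n,s} (E ⊗ F)` are determined by their values on symmetric products of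
elementary tensors. -/
theorem hom_ext_symProd_tmul {W : Type*} [AddCommGroup W] [Module 𝕜 W]
    {f g : SymTensor 𝕜 n (E ⊗[𝕜] F) →ₗ[𝕜] W}
    (h : ∀ (x : Fin n → E) (y : Fin n → F),
      f (symProd fun i => x i ⊗ₜ y i) = g (symProd fun i => x i ⊗ₜ y i)) : f = g := by
  have key : f ∘ₗ symmetrize 𝕜 n _ = g ∘ₗ symmetrize 𝕜 n _ :=
    tensor_tmul_ext fun x y => by simpa using h x y
  ext z
  simpa using LinearMap.congr_fun key (incl 𝕜 n _ z)

theorem split_map {E' F' : Type u} [AddCommGroup E'] [Module 𝕜 E'] [AddCommGroup F']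
    [Module 𝕜 F'] (S : E →ₗ[𝕜] E') (T : F →ₗ[𝕜] F') (u : SymTensor 𝕜 n (E ⊗[𝕜] F)) :
    split 𝕜 n E' F' (map (TensorProduct.map S T) u) =
      TensorProduct.map (map S) (map T) (split 𝕜 n E F u) := by
  refine LinearMap.congr_fun (f := split 𝕜 n E' F' ∘ₗ map (TensorProduct.map S T))
    (g := TensorProduct.map (map S) (map T) ∘ₗ split 𝕜 n E F)
    (hom_ext_symProd_tmul fun x y => ?_) u
  simp only [LinearMap.comp_apply, map_symProd, TensorProduct.map_tmul, split_symProd]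

/-- The splitting map is adjoint to the formation of powers of product functionals. -/
theorem dualDistrib_split_pow (f : SymTensor 𝕜 n E →ₗ[𝕜] 𝕜) (g : SymTensor 𝕜 n F →ₗ[𝕜] 𝕜)
    (φ : E →ₗ[𝕜] 𝕜) (ψ : F →ₗ[𝕜] 𝕜) (hf : ∀ x, f (pow 𝕜 n x) = φ x ^ n)
    (hg : ∀ y, g (pow 𝕜 n y) = ψ y ^ n) (t : E ⊗[𝕜] F) :
    TensorProduct.dualDistrib 𝕜 _ _ (f ⊗ₜ g) (split 𝕜 n E F (pow 𝕜 n t)) =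
      (TensorProduct.dualDistrib 𝕜 E F (φ ⊗ₜ ψ) t) ^ n := by
  -- A functional with values `φ(x)ⁿ` on powers has values `∏ φ(xᵢ)` on symmetric products.
  have aux : ∀ {E : Type u} [AddCommGroup E] [Module 𝕜 E] (f : SymTensor 𝕜 n E →ₗ[𝕜] 𝕜)
      (φ : E →ₗ[𝕜] 𝕜) (_ : ∀ x, f (pow 𝕜 n x) = φ x ^ n) (x : Fin n → E),
      f (symProd x) = ∏ i, φ (x i) := by
    intro E _ _ f φ hf x
    have h1 : f = PiTensorProduct.dualDistrib (PiTensorProduct.tprod 𝕜 fun _ : Fin n => φ) ∘ₗ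
        incl 𝕜 n E := hom_ext fun x => by simp [hf]
    have : (n.factorial : 𝕜) ≠ 0 := by exact_mod_cast n.factorial_ne_zero
    rw [h1, LinearMap.comp_apply, incl_symProd]
    simp only [map_smul, map_sum, PiTensorProduct.dualDistrib_apply]
    simp only [fun σ : Equiv.Perm (Fin n) => Equiv.prod_comp σ fun i => φ (x i)]
    simp [Finset.sum_const, Fintype.card_perm, this]
  have key : (TensorProduct.dualDistrib 𝕜 _ _ (f ⊗ₜ g)) ∘ₗ split 𝕜 n E F =
      PiTensorProduct.dualDistrib (PiTensorProduct.tprod 𝕜 fun _ : Fin n =>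
        TensorProduct.dualDistrib 𝕜 E F (φ ⊗ₜ ψ)) ∘ₗ incl 𝕜 n _ := by
    refine hom_ext_symProd_tmul fun x y => ?_
    rw [LinearMap.comp_apply, split_symProd, TensorProduct.dualDistrib_apply, aux f φ hf,
      aux g ψ hg, LinearMap.comp_apply]
    have h2 := aux (PiTensorProduct.dualDistrib (PiTensorProduct.tprod 𝕜 fun _ : Fin n =>
        TensorProduct.dualDistrib 𝕜 E F (φ ⊗ₜ ψ)) ∘ₗ incl 𝕜 n _)
      (TensorProduct.dualDistrib 𝕜 E F (φ ⊗ₜ ψ)) (fun t => by simp) (fun i => x i ⊗ₜ y i)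
    rw [LinearMap.comp_apply] at h2
    rw [h2]
    simp [Finset.prod_mul_distrib]
  have := LinearMap.congr_fun key (pow 𝕜 n t)
  simpa using this

end Split

end Algebra

end SymTensor

/-! ### Norms on symmetric tensors and duality over finite-dimensional spaces -/

section Duality

variable {𝕜 : Type} [RCLike 𝕜] {n : ℕ}

namespace FinSTensorNorm

variable (α : FinSTensorNorm.{u} 𝕜 n) {E F : Type u} [NormedAddCommGroup E] [NormedSpace 𝕜 E]
  [NormedAddCommGroup F] [NormedSpace 𝕜 F]

theorem ext_nonneg (z : SymTensor 𝕜 n E) : 0 ≤ α.ext E z :=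
  le_csInf (α.extSet_nonempty z) (α.extSet_nonneg z)

theorem ext_eq_norm [FiniteDimensional 𝕜 E] (z : SymTensor 𝕜 n E) : α.ext E z = α.norm E z := by
  apply le_antisymm
  · let i : E →L[𝕜] (⊤ : Submodule 𝕜 E) := (ContinuousLinearMap.id 𝕜 E).codRestrict _ (by simp)
    have hi : ‖i‖ ≤ 1 := i.opNorm_le_bound zero_le_one fun x => by rw [one_mul]; exact le_rfl
    have e : (⊤ : Submodule 𝕜 E).subtype ∘ₗ i.toLinearMap = LinearMap.id := by ext; rfl
    have h := α.ext_le ⊤ (SymTensor.map i.toLinearMap z)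
    rw [SymTensor.map_map, e, SymTensor.map_id] at h
    exact h.trans (α.map_le _ _ i hi z)
  · refine α.le_ext z _ fun M _ w hw => ?_
    rw [← hw]
    exact α.map_le _ _ M.subtypeL M.norm_subtypeL_le w

/-- To bound a number by a multiple of `α(z; ⊗^{n,s} E)`, it suffices to consider the
finite-dimensional subspaces that carry `z`. -/
theorem le_mul_ext {a x : ℝ} (ha : 0 ≤ a) (z : SymTensor 𝕜 n E)
    (h : ∀ (M : Submodule 𝕜 E) [FiniteDimensional 𝕜 M] (w : SymTensor 𝕜 n M),
      SymTensor.map M.subtype w = z → x ≤ a * α.ext M w) : x ≤ a * α.ext E z := by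
  rcases ha.eq_or_lt with rfl | ha
  · obtain ⟨M, hM, w, hw⟩ := SymTensor.exists_finiteDimensional z
    simpa using h M w hw
  · rw [← div_le_iff₀' ha]
    refine α.le_ext z _ fun M _ w hw => ?_
    rw [div_le_iff₀' ha, ← α.ext_eq_norm]
    exact h M w hw

/-- A contraction `T : E → F` induces a contraction `⊗^{n,s}_α E → ⊗^{n,s}_α F`. -/
def spaceMap (T : E →L[𝕜] F) (hT : ‖T‖ ≤ 1) : α.Space E →L[𝕜] α.Space F :=
  LinearMap.mkContinuous (α.toSpace.toLinearMap ∘ₗ SymTensor.map T.toLinearMap ∘ₗ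
    (α.toSpace (E := E)).symm.toLinearMap) 1 fun z => by
      rw [one_mul]
      exact α.ext_map_le T hT _

theorem norm_spaceMap_le (T : E →L[𝕜] F) (hT : ‖T‖ ≤ 1) : ‖α.spaceMap T hT‖ ≤ 1 :=
  LinearMap.mkContinuous_norm_le _ zero_le_one _

theorem norm_toSpace (z : SymTensor 𝕜 n E) : ‖α.toSpace z‖ = α.ext E z := rfl

end FinSTensorNorm

namespace SymTensor

variable {M : Type u} [NormedAddCommGroup M] [NormedSpace 𝕜 M]

instance [FiniteDimensional 𝕜 M] : FiniteDimensional 𝕜 (SymTensor 𝕜 n M) :=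
  inferInstanceAs (FiniteDimensional 𝕜 (symSubmodule 𝕜 n M))

variable (𝕜 M) in
/-- The canonical isometry of a finite-dimensional space onto its bidual. -/
def bidual [FiniteDimensional 𝕜 M] : M ≃ₗᵢ[𝕜] StrongDual 𝕜 (StrongDual 𝕜 M) :=
  LinearIsometry.toLinearIsometryEquiv (NormedSpace.inclusionInDoubleDualLi 𝕜) (by
    have h : ∀ (N : Type u) [NormedAddCommGroup N] [NormedSpace 𝕜 N] [FiniteDimensional 𝕜 N],
        Module.finrank 𝕜 (StrongDual 𝕜 N) = Module.finrank 𝕜 N := fun N _ _ _ => by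
      rw [← Subspace.dual_finrank_eq (K := 𝕜) (V := N)]
      exact (LinearMap.toContinuousLinearMap (𝕜 := 𝕜) (E := N) (F' := 𝕜)).finrank_eq.symm
    rw [h, h])

variable (𝕜 M) in
/-- The canonical contraction of a normed space into its bidual. -/
def toBidual : M →L[𝕜] StrongDual 𝕜 (StrongDual 𝕜 M) := NormedSpace.inclusionInDoubleDual 𝕜 M

variable (𝕜 M) in
/-- The inverse of `toBidual` for a finite-dimensional space. -/
def ofBidual [FiniteDimensional 𝕜 M] : StrongDual 𝕜 (StrongDual 𝕜 M) →L[𝕜] M :=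
  (bidual 𝕜 M).symm.toLinearEquiv.toLinearMap.mkContinuous 1 fun Φ => by
    rw [one_mul]
    exact ((bidual 𝕜 M).symm.norm_map Φ).le

@[simp] theorem toBidual_apply (x : M) (φ : StrongDual 𝕜 M) : toBidual 𝕜 M x φ = φ x := rfl

@[simp] theorem toBidual_ofBidual [FiniteDimensional 𝕜 M] (Φ : StrongDual 𝕜 (StrongDual 𝕜 M)) :
    toBidual 𝕜 M (ofBidual 𝕜 M Φ) = Φ :=
  (bidual 𝕜 M).apply_symm_apply Φ

theorem norm_toBidual_le : ‖toBidual 𝕜 M‖ ≤ 1 := NormedSpace.inclusionInDoubleDual_norm_le 𝕜 M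

theorem norm_ofBidual_le [FiniteDimensional 𝕜 M] : ‖ofBidual 𝕜 M‖ ≤ 1 :=
  LinearMap.mkContinuous_norm_le _ zero_le_one _

/-- The duality bracket is symmetric, up to the canonical map of `M` into its bidual. -/
theorem pairing_bidual (z : SymTensor 𝕜 n M) (w : SymTensor 𝕜 n (StrongDual 𝕜 M)) :
    pairing w (map (toBidual 𝕜 M).toLinearMap z) = pairing z w := by
  have : (pairing (𝕜 := 𝕜) (n := n) (E := StrongDual 𝕜 M)).flip ∘ₗ
      map (toBidual 𝕜 M).toLinearMap = pairing :=
    hom_ext₂ fun x φ => by simp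
  exact LinearMap.congr_fun₂ this z w

variable [FiniteDimensional 𝕜 M]

theorem map_toBidual_map_ofBidual (w : SymTensor 𝕜 n (StrongDual 𝕜 (StrongDual 𝕜 M))) :
    map (toBidual 𝕜 M).toLinearMap
      (map (ofBidual 𝕜 M).toLinearMap w) = w := by
  rw [map_map]
  convert map_id w
  ext x
  simp

/-- For finite-dimensional `M` the bracket between `⊗^{n,s} M` and `⊗^{n,s} M'` is perfect. -/
theorem pairing_isPerfPair : (pairing (𝕜 := 𝕜) (n := n) (E := M)).IsPerfPair := by
  refine LinearMap.IsPerfPair.of_injective ?_ ?_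
  · rw [injective_iff_map_eq_zero]
    intro z hz
    exact eq_zero_of_pairing z fun φ => by rw [hz]; rfl
  · rw [injective_iff_map_eq_zero]
    intro w hw
    refine eq_zero_of_pairing w fun Φ => ?_
    have := LinearMap.congr_fun hw (pow 𝕜 n (ofBidual 𝕜 M Φ))
    rw [LinearMap.flip_apply, ← pairing_bidual, map_pow] at this
    simpa using this

end SymTensor

namespace STensorNorm

open SymTensor

variable (β : STensorNorm.{u} 𝕜 n) {M : Type u} [NormedAddCommGroup M] [NormedSpace 𝕜 M]
  [FiniteDimensional 𝕜 M]

theorem norm_pairing_le_dual_mul_fin (z : SymTensor 𝕜 n M) (w : SymTensor 𝕜 n (StrongDual 𝕜 M)) :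
    ‖pairing z w‖ ≤ β.dual.ext M z * β.fin.ext _ w := by
  have h := (β.dualEval z).le_opNorm (β.fin.toSpace w)
  rwa [← norm_dual_space] at h

theorem dual_ext_le (z : SymTensor 𝕜 n M) {C : ℝ} (hC : 0 ≤ C)
    (h : ∀ w, ‖pairing z w‖ ≤ C * β.fin.ext _ w) : β.dual.ext M z ≤ C := by
  have e : β.dual.ext M z = ‖β.dualEval z‖ := β.norm_dual_space z
  rw [e]
  exact ContinuousLinearMap.opNorm_le_bound _ hC fun w => h (β.fin.toSpace.symm w)

theorem norm_pairing_le_fin_mul_dual (z : SymTensor 𝕜 n M) (w : SymTensor 𝕜 n (StrongDual 𝕜 M)) :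
    ‖pairing z w‖ ≤ β.fin.ext M z * β.dual.ext _ w := by
  rw [← pairing_bidual, mul_comm]
  exact (β.norm_pairing_le_dual_mul_fin w _).trans
    (mul_le_mul_of_nonneg_left (β.fin.ext_map_le _ norm_toBidual_le z) (β.dual.ext_nonneg w))

/-- The identification `(⊗^{n,s}_β M)' = ⊗^{n,s}_{β'} M'`. -/
theorem exists_pairing_of_fin (Λ : StrongDual 𝕜 (β.fin.Space M)) :
    ∃ u : SymTensor 𝕜 n (StrongDual 𝕜 M),
      (∀ v, Λ (β.fin.toSpace v) = pairing v u) ∧ β.dual.ext _ u ≤ ‖Λ‖ := by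
  obtain ⟨u, hu⟩ := (pairing_isPerfPair (𝕜 := 𝕜) (n := n) (M := M)).bijective_right.2
    (Λ.toLinearMap ∘ₗ (β.fin.toSpace (E := M)).toLinearMap)
  have hu' : ∀ v, Λ (β.fin.toSpace v) = pairing v u := fun v => (LinearMap.congr_fun hu v).symm
  refine ⟨u, hu', β.dual_ext_le u (norm_nonneg _) fun w => ?_⟩
  have h1 := pairing_bidual (map (ofBidual 𝕜 M).toLinearMap w) u
  rw [map_toBidual_map_ofBidual] at h1
  rw [h1, ← hu']
  exact (Λ.le_opNorm _).trans (mul_le_mul_of_nonneg_left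
    (β.fin.ext_map_le _ norm_ofBidual_le w) (norm_nonneg _))

/-- The identity `β'' = β` on finite-dimensional spaces, in the form of an upper bound for `β`. -/
theorem fin_ext_le (v : SymTensor 𝕜 n M) {C : ℝ} (hC : 0 ≤ C)
    (h : ∀ u, ‖pairing v u‖ ≤ C * β.dual.ext _ u) : β.fin.ext M v ≤ C := by
  rw [← β.fin.norm_toSpace]
  refine NormedSpace.norm_le_dual_bound 𝕜 _ hC fun Λ => ?_
  obtain ⟨u, hu, hu'⟩ := β.exists_pairing_of_fin Λ
  rw [hu]
  exact (h u).trans (mul_le_mul_of_nonneg_left hu' hC)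

/-- The identification `(⊗^{n,s}_{β'} M)' = ⊗^{n,s}_β M'`. -/
theorem exists_pairing_of_dual (φ : StrongDual 𝕜 (β.dual.Space M)) :
    ∃ z : SymTensor 𝕜 n (StrongDual 𝕜 M),
      (∀ v, φ (β.dual.toSpace v) = pairing v z) ∧ β.fin.ext _ z ≤ ‖φ‖ := by
  obtain ⟨z, hz⟩ := (pairing_isPerfPair (𝕜 := 𝕜) (n := n) (M := M)).bijective_right.2
    (φ.toLinearMap ∘ₗ (β.dual.toSpace (E := M)).toLinearMap)
  have hz' : ∀ v, φ (β.dual.toSpace v) = pairing v z := fun v => (LinearMap.congr_fun hz v).symm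
  refine ⟨z, hz', β.fin_ext_le z (norm_nonneg _) fun w => ?_⟩
  have h1 := pairing_bidual (map (ofBidual 𝕜 M).toLinearMap w) z
  rw [map_toBidual_map_ofBidual] at h1
  rw [h1, ← hz']
  exact (φ.le_opNorm _).trans (mul_le_mul_of_nonneg_left
    (β.dual.ext_map_le _ norm_ofBidual_le w) (norm_nonneg _))

end STensorNorm

end Duality

/-! ### Uniformity of constants -/

section Uniform

variable {𝕜 : Type} [RCLike 𝕜]

/-- A property of pairs of Banach spaces and constants that is monotone in the constant and passes
to contractive retracts, and that holds for each pair with some constant, holds for all pairs with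
one constant: otherwise the `ℓ_∞`-sums of two sequences of counterexamples would violate it for
every constant. -/
theorem exists_uniform_of_retract
    (P : ∀ (E F : Type u) [NormedAddCommGroup E] [NormedSpace 𝕜 E] [CompleteSpace E]
      [NormedAddCommGroup F] [NormedSpace 𝕜 F] [CompleteSpace F], ℝ → Prop)
    (mono : ∀ (E F : Type u) [NormedAddCommGroup E] [NormedSpace 𝕜 E] [CompleteSpace E]
      [NormedAddCommGroup F] [NormedSpace 𝕜 F] [CompleteSpace F] (c d : ℝ), c ≤ d →
      P E F c → P E F d)
    (retract : ∀ (E₀ F₀ E F : Type u) [NormedAddCommGroup E₀] [NormedSpace 𝕜 E₀]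
      [CompleteSpace E₀] [NormedAddCommGroup F₀] [NormedSpace 𝕜 F₀] [CompleteSpace F₀]
      [NormedAddCommGroup E] [NormedSpace 𝕜 E] [CompleteSpace E]
      [NormedAddCommGroup F] [NormedSpace 𝕜 F] [CompleteSpace F]
      (i : E₀ →L[𝕜] E) (p : E →L[𝕜] E₀) (j : F₀ →L[𝕜] F) (q : F →L[𝕜] F₀),
      ‖i‖ ≤ 1 → ‖p‖ ≤ 1 → ‖j‖ ≤ 1 → ‖q‖ ≤ 1 → (∀ x, p (i x) = x) → (∀ y, q (j y) = y) →
      ∀ c, P E F c → P E₀ F₀ c)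
    (exists_const : ∀ (E F : Type u) [NormedAddCommGroup E] [NormedSpace 𝕜 E] [CompleteSpace E]
      [NormedAddCommGroup F] [NormedSpace 𝕜 F] [CompleteSpace F], ∃ c, P E F c) :
    ∃ c, 0 ≤ c ∧ ∀ (E F : Type u) [NormedAddCommGroup E] [NormedSpace 𝕜 E] [CompleteSpace E]
      [NormedAddCommGroup F] [NormedSpace 𝕜 F] [CompleteSpace F], P E F c := by
  by_contra! hcon
  choose E F hE1 hE2 hE3 hF1 hF2 hF3 hP using fun k : ℕ => hcon k k.cast_nonneg
  obtain ⟨c, hc⟩ := exists_const (lp E ⊤) (lp F ⊤)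
  obtain ⟨k, hk⟩ := exists_nat_ge c
  have single_le : ∀ (X : ℕ → Type u) [∀ k, NormedAddCommGroup (X k)] [∀ k, NormedSpace 𝕜 (X k)],
      ‖lp.singleContinuousLinearMap 𝕜 X ⊤ k‖ ≤ 1 := fun X _ _ =>
    ContinuousLinearMap.opNorm_le_bound _ zero_le_one fun x => by
      rw [one_mul, lp.singleContinuousLinearMap_apply, lp.norm_single (by simp)]
  have eval_le : ∀ (X : ℕ → Type u) [∀ k, NormedAddCommGroup (X k)] [∀ k, NormedSpace 𝕜 (X k)],
      ‖lp.evalCLM 𝕜 X ⊤ k‖ ≤ 1 := fun X _ _ => LinearMap.mkContinuous_norm_le _ zero_le_one _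
  exact hP k (mono _ _ c k hk (retract _ _ _ _ (lp.singleContinuousLinearMap 𝕜 E ⊤ k)
    (lp.evalCLM 𝕜 E ⊤ k) (lp.singleContinuousLinearMap 𝕜 F ⊤ k) (lp.evalCLM 𝕜 F ⊤ k)
    (single_le E) (eval_le E) (single_le F) (eval_le F)
    (fun x => lp.single_apply_self ⊤ k x) (fun x => lp.single_apply_self ⊤ k x) c hc))

end Uniform

/-! ### The projective tensor product and bounded bilinear maps -/

section Bilinear

variable {𝕜 : Type} [RCLike 𝕜] {n : ℕ}
  {E F G : Type u} [NormedAddCommGroup E] [NormedSpace 𝕜 E]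
  [NormedAddCommGroup F] [NormedSpace 𝕜 F] [NormedAddCommGroup G] [NormedSpace 𝕜 G]

theorem exists_eq_norm_smul (x : E) : ∃ x' : E, ‖x'‖ ≤ 1 ∧ x = (‖x‖ : 𝕜) • x' := by
  rcases eq_or_ne ‖x‖ 0 with h0 | h0
  · exact ⟨0, by simp, by simpa using h0⟩
  · have hne : (‖x‖ : 𝕜) ≠ 0 := by exact_mod_cast h0
    refine ⟨(‖x‖ : 𝕜)⁻¹ • x, ?_, by rw [smul_inv_smul₀ hne]⟩
    rw [norm_smul, norm_inv, RCLike.norm_ofReal, abs_norm, inv_mul_cancel₀ h0]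

/-- The bilinear map of vector spaces underlying a continuous bilinear map. -/
abbrev bilin (B : E →L[𝕜] F →L[𝕜] G) : E →ₗ[𝕜] F →ₗ[𝕜] G := ContinuousLinearMap.toLinearMap₁₂ B

namespace ProjTensor

variable (𝕜 E F) in
/-- The universal bilinear map `E × F → E ⊗_{π₂} F`. -/
def tmulL : E →L[𝕜] F →L[𝕜] ProjTensor 𝕜 E F :=
  LinearMap.mkContinuous₂ ((TensorProduct.mk 𝕜 E F).compr₂ (of 𝕜 E F).toLinearMap) 1 fun x y => by
    rw [one_mul]
    change projNorm₂ (x ⊗ₜ[𝕜] y) ≤ _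
    simpa using projNorm₂_le (𝕜 := 𝕜) [(x, y)]

@[simp] theorem tmulL_apply (x : E) (y : F) : tmulL 𝕜 E F x y = tmul 𝕜 x y := rfl

theorem norm_tmulL_le : ‖tmulL 𝕜 E F‖ ≤ 1 := LinearMap.mkContinuous₂_norm_le _ zero_le_one _

theorem norm_tmul_le (x : E) (y : F) : ‖tmul 𝕜 x y‖ ≤ ‖x‖ * ‖y‖ := by
  simpa using (tmulL 𝕜 E F).le_of_opNorm₂_le_of_le norm_tmulL_le le_rfl le_rfl (x := x) (y := y)

/-- The projective tensor product linearizes bilinear maps isometrically. -/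
theorem norm_lift (B : E →L[𝕜] F →L[𝕜] G) : ‖lift B‖ = ‖B‖ := by
  refine le_antisymm (LinearMap.mkContinuous_norm_le _ (norm_nonneg _) _)
    (B.opNorm_le_bound₂ (norm_nonneg _) fun x y => ?_)
  rw [← lift_tmul, mul_assoc]
  exact ((lift B).le_opNorm _).trans
    (mul_le_mul_of_nonneg_left (norm_tmul_le x y) (norm_nonneg _))

instance [FiniteDimensional 𝕜 E] [FiniteDimensional 𝕜 F] :
    FiniteDimensional 𝕜 (ProjTensor 𝕜 E F) :=
  inferInstanceAs (FiniteDimensional 𝕜 (E ⊗[𝕜] F))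

end ProjTensor

namespace FinSTensorNorm

/-- A bounded bilinear map between spaces `⊗^{n,s} E`, `⊗^{n,s} F`, `⊗^{n,s} G` with three possibly
different norms, induced by a bilinear map `B : E × F → G`. -/
def spaceMap₂ (α₁ α₂ α₃ : FinSTensorNorm.{u} 𝕜 n) (B : E →ₗ[𝕜] F →ₗ[𝕜] G) (C : ℝ)
    (h : ∀ z w, α₃.ext G (SymTensor.map₂ B z w) ≤ C * α₁.ext E z * α₂.ext F w) :
    α₁.Space E →L[𝕜] α₂.Space F →L[𝕜] α₃.Space G :=
  LinearMap.mkContinuous₂ (((SymTensor.map₂ B).compr₂ α₃.toSpace.toLinearMap).compl₁₂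
    α₁.toSpace.symm.toLinearMap α₂.toSpace.symm.toLinearMap) C fun _ _ => h _ _

variable {α₁ α₂ α₃ : FinSTensorNorm.{u} 𝕜 n} {B : E →ₗ[𝕜] F →ₗ[𝕜] G} {C : ℝ}
    (h : ∀ z w, α₃.ext G (SymTensor.map₂ B z w) ≤ C * α₁.ext E z * α₂.ext F w)

theorem spaceMap₂_pow (x : E) (y : F) :
    spaceMap₂ α₁ α₂ α₃ B C h (α₁.pow x) (α₂.pow y) = α₃.pow (B x y) :=
  congrArg α₃.toSpace (SymTensor.map₂_pow_pow B x y)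

theorem norm_spaceMap₂_le (hC : 0 ≤ C) : ‖spaceMap₂ α₁ α₂ α₃ B C h‖ ≤ C :=
  LinearMap.mkContinuous₂_norm_le _ hC _

/-- A linear map on `⊗^{n,s}_α E` is determined by its values on powers. -/
theorem space_hom_ext {W : Type*} [AddCommGroup W] [Module 𝕜 W] {α : FinSTensorNorm.{u} 𝕜 n}
    {f g : α.Space E →ₗ[𝕜] W} (h : ∀ x, f (α.pow x) = g (α.pow x)) : f = g :=
  SymTensor.hom_ext h

end FinSTensorNorm

namespace STensorNorm

open SymTensor

variable (β : STensorNorm.{u} 𝕜 n)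

/-- `‖B_n‖ ≤ c` for the maps `⊗^{n,s}_β E × ⊗^{n,s}_β F → ⊗^{n,s}_β G` induced by the contractive
bilinear maps `B` from the fixed pair `E`, `F` to a Banach space. -/
def BilinBound (E F : Type u) [NormedAddCommGroup E] [NormedSpace 𝕜 E]
    [NormedAddCommGroup F] [NormedSpace 𝕜 F] (c : ℝ) : Prop :=
  ∀ (G : Type u) [NormedAddCommGroup G] [NormedSpace 𝕜 G] [CompleteSpace G]
    (B : E →L[𝕜] F →L[𝕜] G), ‖B‖ ≤ 1 → ∀ z w,
    β.fin.ext G (map₂ (bilin B) z w) ≤ c * β.fin.ext E z * β.fin.ext F w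

/-- `‖B_n‖ ≤ c` for the maps `⊗^{n,s}_β E × ⊗^{n,s}_β F → ⊗^{n,s}_β G` induced by the contractive
bilinear maps `B` between arbitrary normed spaces. All four conditions of the theorem amount to the
existence of such a `c`, and all four sets of constants consist of precisely these `c`. -/
def MapBound (c : ℝ) : Prop :=
  0 ≤ c ∧ ∀ (E F G : Type u) [NormedAddCommGroup E] [NormedSpace 𝕜 E]
    [NormedAddCommGroup F] [NormedSpace 𝕜 F] [NormedAddCommGroup G] [NormedSpace 𝕜 G]
    (B : E →L[𝕜] F →L[𝕜] G), ‖B‖ ≤ 1 → ∀ z w,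
    β.fin.ext G (map₂ (bilin B) z w) ≤ c * β.fin.ext E z * β.fin.ext F w

variable {β}

theorem BilinBound.mono {c d : ℝ} (hcd : c ≤ d) (h : β.BilinBound E F c) : β.BilinBound E F d :=
  fun G _ _ _ B hB z w => (h G B hB z w).trans (mul_le_mul_of_nonneg_right
    (mul_le_mul_of_nonneg_right hcd (β.fin.ext_nonneg z)) (β.fin.ext_nonneg w))

theorem BilinBound.retract {E₀ F₀ : Type u} [NormedAddCommGroup E₀] [NormedSpace 𝕜 E₀]
    [NormedAddCommGroup F₀] [NormedSpace 𝕜 F₀] {c : ℝ} (hc : 0 ≤ c)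
    (i : E₀ →L[𝕜] E) (p : E →L[𝕜] E₀) (j : F₀ →L[𝕜] F) (q : F →L[𝕜] F₀)
    (hi : ‖i‖ ≤ 1) (hp : ‖p‖ ≤ 1) (hj : ‖j‖ ≤ 1) (hq : ‖q‖ ≤ 1) (hpi : ∀ x, p (i x) = x)
    (hqj : ∀ y, q (j y) = y) (h : β.BilinBound E F c) : β.BilinBound E₀ F₀ c := by
  intro G _ _ _ B hB z w
  have hB' : ‖B.bilinearComp p q‖ ≤ 1 := by
    refine ContinuousLinearMap.opNorm_le_bound₂ _ zero_le_one fun x y => ?_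
    rw [one_mul, ContinuousLinearMap.bilinearComp_apply]
    have h1 := p.le_of_opNorm_le hp x
    have h2 := q.le_of_opNorm_le hq y
    rw [one_mul] at h1 h2
    simpa using B.le_of_opNorm₂_le_of_le hB h1 h2
  have e := map_map₂_eq (n := n) (B := bilin B) (B' := bilin (B.bilinearComp p q))
    i.toLinearMap j.toLinearMap LinearMap.id (by simp [hpi, hqj]) z w
  rw [SymTensor.map_id] at e
  rw [e]
  refine (h G _ hB' _ _).trans (mul_le_mul (mul_le_mul_of_nonneg_left
    (β.fin.ext_map_le i hi z) hc) (β.fin.ext_map_le j hj w) (β.fin.ext_nonneg _)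
    (mul_nonneg hc (β.fin.ext_nonneg _)))

/-- Bilinear maps into any normed space are controlled by the universal one. -/
theorem ext_map₂_le_of_tmulL (B : E →L[𝕜] F →L[𝕜] G) (hB : ‖B‖ ≤ 1)
    (z : SymTensor 𝕜 n E) (w : SymTensor 𝕜 n F) :
    β.fin.ext G (map₂ (bilin B) z w) ≤
      β.fin.ext (ProjTensor 𝕜 E F) (map₂ (bilin (ProjTensor.tmulL 𝕜 E F)) z w) := by
  have e := map_map₂_eq (n := n) (B := bilin (ProjTensor.tmulL 𝕜 E F)) (B' := bilin B)
    LinearMap.id LinearMap.id (ProjTensor.lift B).toLinearMap (by simp) z w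
  rw [SymTensor.map_id, SymTensor.map_id] at e
  rw [← e]
  exact β.fin.ext_map_le _ ((ProjTensor.norm_lift B).trans_le hB) _

variable (β) in
/-- It suffices to control the universal bilinear maps of finite-dimensional spaces. -/
theorem mapBound_of_finiteDimensional {c : ℝ} (hc : 0 ≤ c)
    (h : ∀ (M N : Type u) [NormedAddCommGroup M] [NormedSpace 𝕜 M] [NormedAddCommGroup N]
      [NormedSpace 𝕜 N] [FiniteDimensional 𝕜 M] [FiniteDimensional 𝕜 N] (z : SymTensor 𝕜 n M)
      (w : SymTensor 𝕜 n N), β.fin.ext (ProjTensor 𝕜 M N)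
        (map₂ (bilin (ProjTensor.tmulL 𝕜 M N)) z w) ≤ c * β.fin.ext M z * β.fin.ext N w) :
    β.MapBound c := by
  refine ⟨hc, fun E F G _ _ _ _ _ _ B hB z w => ?_⟩
  refine β.fin.le_mul_ext (mul_nonneg hc (β.fin.ext_nonneg z)) w fun N _ w₀ hw => ?_
  rw [mul_right_comm]
  refine β.fin.le_mul_ext (mul_nonneg hc (β.fin.ext_nonneg w₀)) z fun M _ z₀ hz => ?_
  rw [mul_right_comm]
  have hB' : ‖B.bilinearComp M.subtypeL N.subtypeL‖ ≤ 1 := by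
    refine ContinuousLinearMap.opNorm_le_bound₂ _ zero_le_one fun x y => ?_
    simpa using B.le_of_opNorm₂_le_of_le hB (le_refl ‖(x : E)‖) (le_refl ‖(y : F)‖)
  have e := map_map₂_eq (n := n) (B := bilin (B.bilinearComp M.subtypeL N.subtypeL))
    (B' := bilin B) M.subtype N.subtype LinearMap.id (by simp) z₀ w₀
  rw [SymTensor.map_id, hz, hw] at e
  rw [← e]
  exact (ext_map₂_le_of_tmulL _ hB' z₀ w₀).trans (h M N z₀ w₀)

variable (β) in
theorem mapBound_of_bilinBound {c : ℝ} (hc : 0 ≤ c)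
    (h : ∀ (E F : Type u) [NormedAddCommGroup E] [NormedSpace 𝕜 E] [CompleteSpace E]
      [NormedAddCommGroup F] [NormedSpace 𝕜 F] [CompleteSpace F], β.BilinBound E F c) :
    β.MapBound c :=
  β.mapBound_of_finiteDimensional hc fun M N _ _ _ _ _ _ z w => by
    have := FiniteDimensional.complete 𝕜 M
    have := FiniteDimensional.complete 𝕜 N
    have := FiniteDimensional.complete 𝕜 (ProjTensor 𝕜 M N)
    exact h M N _ _ ProjTensor.norm_tmulL_le z w

variable (β) in
theorem exists_mapBound_of_bilinBound
    (h : ∀ (E F : Type u) [NormedAddCommGroup E] [NormedSpace 𝕜 E] [CompleteSpace E]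
      [NormedAddCommGroup F] [NormedSpace 𝕜 F] [CompleteSpace F],
      ∃ c, β.BilinBound E F c) : ∃ c, β.MapBound c := by
  obtain ⟨c, hc, hc'⟩ := exists_uniform_of_retract (𝕜 := 𝕜)
    (fun E F _ _ _ _ _ _ c => 0 ≤ c ∧ β.BilinBound E F c)
    (fun E F _ _ _ _ _ _ c d hcd h => ⟨h.1.trans hcd, h.2.mono hcd⟩)
    (fun E₀ F₀ E F _ _ _ _ _ _ _ _ _ _ _ _ i p j q hi hp hj hq hpi hqj c hc =>
      ⟨hc.1, hc.2.retract hc.1 i p j q hi hp hj hq hpi hqj⟩)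
    (fun E F _ _ _ _ _ _ => by
      obtain ⟨c, hc⟩ := h E F
      exact ⟨max c 0, le_max_right _ _, hc.mono (le_max_left _ _)⟩)
  exact ⟨c, β.mapBound_of_bilinBound hc fun E F _ _ _ _ _ _ => (hc' E F).2⟩

/-- The bound for general `B`, by homogeneity of degree `n`. -/
theorem MapBound.ext_map₂_le {c : ℝ} (h : β.MapBound c) (B : E →L[𝕜] F →L[𝕜] G)
    (z : SymTensor 𝕜 n E) (w : SymTensor 𝕜 n F) :
    β.fin.ext G (map₂ (bilin B) z w) ≤ c * ‖B‖ ^ n * β.fin.ext E z * β.fin.ext F w := by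
  obtain ⟨B', hB', e⟩ := exists_eq_norm_smul (𝕜 := 𝕜) B
  have e' : map₂ (n := n) (bilin B) = (‖B‖ : 𝕜) ^ n • map₂ (bilin B') := by
    rw [← map₂_smul]
    conv_lhs => rw [e]
    rfl
  rw [e', LinearMap.smul_apply, LinearMap.smul_apply]
  refine (β.fin.ext_smul_le _ _).trans ?_
  rw [norm_pow, RCLike.norm_ofReal, abs_norm]
  calc _ ≤ ‖B‖ ^ n * (c * β.fin.ext E z * β.fin.ext F w) :=
        mul_le_mul_of_nonneg_left (h.2 E F G B' hB' z w) (by positivity)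
    _ = _ := by ring

variable (β) in
/-- If there are constants at all, there is a least one. -/
theorem exists_isLeast_mapBound (h : ∃ c, β.MapBound c) : ∃ c, IsLeast {c | β.MapBound c} c := by
  have hb : BddBelow {c | β.MapBound c} := ⟨0, fun c hc => hc.1⟩
  refine ⟨sInf {c | β.MapBound c}, ⟨le_csInf h fun c hc => hc.1,
    fun E F G _ _ _ _ _ _ B hB z w => ?_⟩, fun c hc => csInf_le hb hc⟩
  rw [mul_assoc]
  rcases (mul_nonneg (β.fin.ext_nonneg z) (β.fin.ext_nonneg w)).eq_or_lt with h0 | h0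
  · obtain ⟨c, hc⟩ := h
    have := hc.2 E F G B hB z w
    rw [mul_assoc, ← h0, mul_zero] at this
    rwa [← h0, mul_zero]
  · rw [← div_le_iff₀ h0]
    refine le_csInf h fun c hc => ?_
    rw [div_le_iff₀ h0, ← mul_assoc]
    exact hc.2 E F G B hB z w

/-! ### The map on projective tensor products -/

theorem MapBound.exists_f {c : ℝ} (h : β.MapBound c) (E F : Type u) [NormedAddCommGroup E]
    [NormedSpace 𝕜 E] [NormedAddCommGroup F] [NormedSpace 𝕜 F] :
    ∃ f : ProjTensor 𝕜 (β.fin.Space E) (β.fin.Space F) →L[𝕜] β.fin.Space (ProjTensor 𝕜 E F),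
      β.IsNaturalF f ∧ ‖f‖ ≤ c := by
  refine ⟨ProjTensor.lift (FinSTensorNorm.spaceMap₂ _ _ _ _ c
    (h.2 E F _ (ProjTensor.tmulL 𝕜 E F) ProjTensor.norm_tmulL_le)), fun x y => ?_, ?_⟩
  · rw [ProjTensor.lift_tmul, FinSTensorNorm.spaceMap₂_pow]
    rfl
  · rw [ProjTensor.norm_lift]
    exact FinSTensorNorm.norm_spaceMap₂_le _ h.1

theorem IsNaturalF.bilinBound {f : ProjTensor 𝕜 (β.fin.Space E) (β.fin.Space F) →L[𝕜]
    β.fin.Space (ProjTensor 𝕜 E F)} (hf : β.IsNaturalF f) : β.BilinBound E F ‖f‖ := by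
  intro G _ _ _ B hB z w
  refine (ext_map₂_le_of_tmulL B hB z w).trans ?_
  have e : (bilin (ProjTensor.tmulL 𝕜 (β.fin.Space E) (β.fin.Space F))).compr₂ f.toLinearMap =
      ((map₂ (bilin (ProjTensor.tmulL 𝕜 E F))).compr₂ β.fin.toSpace.toLinearMap).compl₁₂
        β.fin.toSpace.symm.toLinearMap β.fin.toSpace.symm.toLinearMap :=
    FinSTensorNorm.space_hom_ext fun x => FinSTensorNorm.space_hom_ext fun y =>
      (hf x y).trans (congrArg β.fin.toSpace
        (map₂_pow_pow (bilin (ProjTensor.tmulL 𝕜 E F)) x y).symm)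
  have e' : f (ProjTensor.tmul 𝕜 (β.fin.toSpace z) (β.fin.toSpace w)) =
      β.fin.toSpace (map₂ (bilin (ProjTensor.tmulL 𝕜 E F)) z w) :=
    LinearMap.congr_fun₂ e (β.fin.toSpace z) (β.fin.toSpace w)
  rw [← FinSTensorNorm.norm_toSpace, ← e', mul_assoc]
  exact (f.le_opNorm _).trans
    (mul_le_mul_of_nonneg_left (ProjTensor.norm_tmul_le _ _) (norm_nonneg f))

variable (β) in
theorem hasNaturalF_iff : β.HasNaturalF ↔ ∃ c, β.MapBound c := by
  refine ⟨fun h => β.exists_mapBound_of_bilinBound fun E F _ _ _ _ _ _ => ?_, ?_⟩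
  · obtain ⟨f, hf⟩ := h E F
    exact ⟨_, hf.bilinBound⟩
  · rintro ⟨c, hc⟩ E F _ _ _ _ _ _
    obtain ⟨f, hf, -⟩ := hc.exists_f E F
    exact ⟨f, hf⟩

variable (β) in
theorem fConstants_eq : β.fConstants = {c | β.MapBound c} := by
  refine Set.Subset.antisymm (fun c hc => ?_) fun c hc E F _ _ _ _ _ _ => hc.exists_f E F
  have hc0 : 0 ≤ c := by
    obtain ⟨f, -, hf⟩ := hc PUnit PUnit
    exact (norm_nonneg f).trans hf
  refine β.mapBound_of_bilinBound hc0 fun E F _ _ _ _ _ _ => ?_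
  obtain ⟨f, hf, hf'⟩ := hc E F
  exact hf.bilinBound.mono hf'

end STensorNorm

end Bilinear

/-! ### Banach algebras -/

section Algebras

variable {𝕜 : Type} [RCLike 𝕜]

/-- A continuous bilinear map extends to the completions without increasing its norm. -/
theorem exists_completion_bilinear {S : Type u} [NormedAddCommGroup S] [NormedSpace 𝕜 S]
    (B : S →L[𝕜] S →L[𝕜] S) :
    ∃ M : UniformSpace.Completion S →L[𝕜] UniformSpace.Completion S →L[𝕜]
      UniformSpace.Completion S, (∀ a b : S, M a b = (B a b : S)) ∧ ‖M‖ ≤ ‖B‖ := by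
  let e : S →L[𝕜] UniformSpace.Completion S := UniformSpace.Completion.toComplL
  have he : DenseRange e := UniformSpace.Completion.denseRange_coe
  have hi : IsUniformInducing e := UniformSpace.Completion.isUniformInducing_coe S
  have hn : ∀ x : S, ‖x‖ ≤ (1 : NNReal) * ‖e x‖ := fun x => by
    rw [NNReal.coe_one, one_mul]
    exact (UniformSpace.Completion.norm_coe x).ge
  -- Extend in the first variable, exchange the variables, and extend again.
  let B₀ : S →L[𝕜] S →L[𝕜] UniformSpace.Completion S :=
    (ContinuousLinearMap.compL 𝕜 S S (UniformSpace.Completion S) e).comp B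
  let B₁ : UniformSpace.Completion S →L[𝕜] S →L[𝕜] UniformSpace.Completion S := B₀.extend e
  let B₂ : UniformSpace.Completion S →L[𝕜] UniformSpace.Completion S →L[𝕜]
    UniformSpace.Completion S := B₁.flip.extend e
  have h1 : ∀ {X : Type u} [NormedAddCommGroup X] [NormedSpace 𝕜 X] [CompleteSpace X]
      (T : S →L[𝕜] X), ‖T.extend e‖ ≤ ‖T‖ := fun T => by
    simpa using T.opNorm_extend_le he hn
  refine ⟨B₂.flip, fun a b => ?_, ?_⟩
  · change (B₁.flip.extend e) (e b) (e a) = e (B a b)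
    rw [ContinuousLinearMap.extend_eq _ he hi, ContinuousLinearMap.flip_apply]
    change (B₀.extend e) (e a) b = _
    rw [ContinuousLinearMap.extend_eq _ he hi]
    rfl
  · have h0 : ‖B₀‖ ≤ ‖B‖ := B₀.opNorm_le_bound₂ (norm_nonneg _) fun a b => by
      refine le_trans (le_of_eq ?_) (B.le_opNorm₂ a b)
      exact UniformSpace.Completion.norm_coe (B a b)
    rw [ContinuousLinearMap.opNorm_flip]
    refine (h1 _).trans ?_
    rw [ContinuousLinearMap.opNorm_flip]
    exact (h1 _).trans h0

section Triangular

variable {E F G : Type u} [NormedAddCommGroup E] [NormedSpace 𝕜 E]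
  [NormedAddCommGroup F] [NormedSpace 𝕜 F] [NormedAddCommGroup G] [NormedSpace 𝕜 G]

/-- The multiplication `(x, y, v)(x', y', v') = (0, 0, B(x, y'))` on `E × F × G`. All triple
products vanish, so that it is associative. -/
def triMul (B : E →L[𝕜] F →L[𝕜] G) : (E × F × G) →L[𝕜] (E × F × G) →L[𝕜] (E × F × G) :=
  (ContinuousLinearMap.compL 𝕜 (E × F × G) G (E × F × G)
    ((ContinuousLinearMap.inr 𝕜 E (F × G)).comp (ContinuousLinearMap.inr 𝕜 F G))).comp
    (B.bilinearComp (ContinuousLinearMap.fst 𝕜 E (F × G))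
      ((ContinuousLinearMap.fst 𝕜 F G).comp (ContinuousLinearMap.snd 𝕜 E (F × G))))

@[simp] theorem triMul_apply (B : E →L[𝕜] F →L[𝕜] G) (a b : E × F × G) :
    triMul B a b = (0, 0, B a.1 b.2.1) := rfl

theorem isAssocMul_triMul (B : E →L[𝕜] F →L[𝕜] G) : IsAssocMul (triMul B) := fun a b c => by
  simp

theorem norm_triMul_le (B : E →L[𝕜] F →L[𝕜] G) (hB : ‖B‖ ≤ 1) : ‖triMul B‖ ≤ 1 := by
  refine ContinuousLinearMap.opNorm_le_bound₂ _ zero_le_one fun a b => ?_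
  have h1 : ‖a.1‖ ≤ ‖a‖ := le_max_left _ _
  have h2 : ‖b.2.1‖ ≤ ‖b‖ := (le_max_left _ _).trans (le_max_right _ _)
  have h3 := B.le_of_opNorm₂_le_of_le hB h1 h2
  simpa [Prod.norm_def] using h3

end Triangular

variable {n : ℕ}

namespace STensorNorm

open SymTensor

variable {β : STensorNorm.{u} 𝕜 n} {E F G : Type u} [NormedAddCommGroup E] [NormedSpace 𝕜 E]
  [NormedAddCommGroup F] [NormedSpace 𝕜 F] [NormedAddCommGroup G] [NormedSpace 𝕜 G]

theorem IsNaturalMul.apply_coe {m : E →L[𝕜] E →L[𝕜] E}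
    {M : β.ComplSpace E →L[𝕜] β.ComplSpace E →L[𝕜] β.ComplSpace E} (h : β.IsNaturalMul m M)
    (z w : SymTensor 𝕜 n E) :
    M (β.fin.toSpace z : β.fin.Space E) (β.fin.toSpace w : β.fin.Space E) =
      (β.fin.toSpace (map₂ (bilin m) z w) : β.fin.Space E) := by
  let e : β.fin.Space E →ₗ[𝕜] β.ComplSpace E := UniformSpace.Completion.toComplL.toLinearMap
  have key : (bilin M).compl₁₂ e e = ((map₂ (bilin m)).compr₂
      (e ∘ₗ β.fin.toSpace.toLinearMap)).compl₁₂ β.fin.toSpace.symm.toLinearMap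
        β.fin.toSpace.symm.toLinearMap :=
    FinSTensorNorm.space_hom_ext fun x => FinSTensorNorm.space_hom_ext fun y =>
      (h x y).trans (congrArg (fun v => e (β.fin.toSpace v)) (map₂_pow_pow (bilin m) x y).symm)
  exact LinearMap.congr_fun₂ key (β.fin.toSpace z) (β.fin.toSpace w)

/-- The multiplication of the algebra `E × F × G` yields a bound for the map induced by `B`, since
`E`, `F` and `G` are complemented in the algebra by contractive projections. -/
theorem IsNaturalMul.ext_map₂_le {B : E →L[𝕜] F →L[𝕜] G}
    {M : β.ComplSpace (E × F × G) →L[𝕜] β.ComplSpace (E × F × G) →L[𝕜] β.ComplSpace (E × F × G)}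
    (h : β.IsNaturalMul (triMul B) M) (z : SymTensor 𝕜 n E) (w : SymTensor 𝕜 n F) :
    β.fin.ext G (map₂ (bilin B) z w) ≤ ‖M‖ * β.fin.ext E z * β.fin.ext F w := by
  let iE : E →L[𝕜] E × F × G := ContinuousLinearMap.inl 𝕜 E (F × G)
  let iF : F →L[𝕜] E × F × G :=
    (ContinuousLinearMap.inr 𝕜 E (F × G)).comp (ContinuousLinearMap.inl 𝕜 F G)
  let iG : G →L[𝕜] E × F × G :=
    (ContinuousLinearMap.inr 𝕜 E (F × G)).comp (ContinuousLinearMap.inr 𝕜 F G)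
  let pG : E × F × G →L[𝕜] G :=
    (ContinuousLinearMap.snd 𝕜 F G).comp (ContinuousLinearMap.snd 𝕜 E (F × G))
  have hE : ‖iE‖ ≤ 1 := iE.opNorm_le_bound zero_le_one fun x => by simp [iE, Prod.norm_def]
  have hF : ‖iF‖ ≤ 1 := iF.opNorm_le_bound zero_le_one fun x => by simp [iF, Prod.norm_def]
  have hG : ‖pG‖ ≤ 1 := pG.opNorm_le_bound zero_le_one fun x => by simp [pG, Prod.norm_def]
  have e1 := map_map₂_eq (n := n) (B := bilin B) (B' := bilin (triMul B))
    iE.toLinearMap iF.toLinearMap iG.toLinearMap (fun x y => rfl) z w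
  have e2 : map₂ (bilin B) z w = map pG.toLinearMap (map iG.toLinearMap (map₂ (bilin B) z w)) := by
    rw [map_map]
    exact (map_id _).symm
  rw [e2]
  refine (β.fin.ext_map_le pG hG _).trans ?_
  rw [e1, ← FinSTensorNorm.norm_toSpace, ← UniformSpace.Completion.norm_coe, ← h.apply_coe]
  refine M.le_of_opNorm₂_le_of_le le_rfl ?_ ?_
  · rw [UniformSpace.Completion.norm_coe]
    exact β.fin.ext_map_le iE hE z
  · rw [UniformSpace.Completion.norm_coe]
    exact β.fin.ext_map_le iF hF w

theorem MapBound.exists_mul {c : ℝ} (h : β.MapBound c) (A : Type u) [NormedAddCommGroup A]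
    [NormedSpace 𝕜 A] (m : A →L[𝕜] A →L[𝕜] A) (hm : IsAssocMul m) :
    ∃ M : β.ComplSpace A →L[𝕜] β.ComplSpace A →L[𝕜] β.ComplSpace A,
      IsAssocMul M ∧ β.IsNaturalMul m M ∧ ‖ProjTensor.lift M‖ ≤ c * ‖ProjTensor.lift m‖ ^ n := by
  have hc : 0 ≤ c * ‖m‖ ^ n := mul_nonneg h.1 (by positivity)
  let B : β.fin.Space A →L[𝕜] β.fin.Space A →L[𝕜] β.fin.Space A :=
    FinSTensorNorm.spaceMap₂ _ _ _ (bilin m) (c * ‖m‖ ^ n) (h.ext_map₂_le m)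
  have hB : ∀ a b d, B (B a b) d = B a (B b d) := by
    have key : ∀ z w v : SymTensor 𝕜 n A, map₂ (bilin m) (map₂ (bilin m) z w) v =
        map₂ (bilin m) z (map₂ (bilin m) w v) := by
      intro z w v
      induction z using SymTensor.induction with
      | hpow x =>
        induction w using SymTensor.induction with
        | hpow y =>
          induction v using SymTensor.induction with
          | hpow t =>
            simp only [map₂_pow_pow]
            exact congrArg (pow 𝕜 n) (hm x y t)
          | h0 => simp
          | hadd z w hz hw => simp only [map_add, hz, hw]
          | hsmul c z hz => simp only [map_smul, hz]
        | h0 => simp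
        | hadd z w hz hw => simp only [map_add, LinearMap.add_apply, hz, hw]
        | hsmul c z hz => simp only [map_smul, LinearMap.smul_apply, hz]
      | h0 => simp
      | hadd z w hz hw => simp only [map_add, LinearMap.add_apply, hz, hw]
      | hsmul c z hz => simp only [map_smul, LinearMap.smul_apply, hz]
    exact key
  obtain ⟨M, hM, hM'⟩ := exists_completion_bilinear B
  refine ⟨M, fun a b d => ?_, fun x y => ?_, ?_⟩
  · refine UniformSpace.Completion.induction_on₃ a b d ?_ fun x y t => ?_
    · exact isClosed_eq (by fun_prop) (by fun_prop)
    · rw [hM, hM, hM, hM, hB]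
  · rw [hM]
    exact congrArg _ (FinSTensorNorm.spaceMap₂_pow _ x y)
  · rw [ProjTensor.norm_lift, ProjTensor.norm_lift]
    exact hM'.trans (FinSTensorNorm.norm_spaceMap₂_le _ hc)

variable (𝕜 E F) in
/-- The universal bilinear map `E × F → E ⊗_{π₂} F`, followed by the embedding into the
completion. -/
def complTmulL : E →L[𝕜] F →L[𝕜] UniformSpace.Completion (ProjTensor 𝕜 E F) :=
  (ContinuousLinearMap.compL 𝕜 F _ _ UniformSpace.Completion.toComplL).comp
    (ProjTensor.tmulL 𝕜 E F)

/-- A bound for the universal bilinear map into the completion of `E ⊗_{π₂} F` bounds all bilinear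
maps into Banach spaces. -/
theorem bilinBound_of_complTmulL {c : ℝ}
    (h : ∀ z w, β.fin.ext _ (map₂ (bilin (complTmulL 𝕜 E F)) z w) ≤
      c * β.fin.ext E z * β.fin.ext F w) : β.BilinBound E F c := by
  intro G _ _ _ B hB z w
  let e : ProjTensor 𝕜 E F →L[𝕜] UniformSpace.Completion (ProjTensor 𝕜 E F) :=
    UniformSpace.Completion.toComplL
  have he : DenseRange e := UniformSpace.Completion.denseRange_coe
  have hi : IsUniformInducing e := UniformSpace.Completion.isUniformInducing_coe _
  have hn : ∀ x : ProjTensor 𝕜 E F, ‖x‖ ≤ (1 : NNReal) * ‖e x‖ := fun x => by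
    rw [NNReal.coe_one, one_mul]
    exact (UniformSpace.Completion.norm_coe x).ge
  let L : UniformSpace.Completion (ProjTensor 𝕜 E F) →L[𝕜] G := (ProjTensor.lift B).extend e
  have hL : ‖L‖ ≤ 1 := by
    have := (ProjTensor.lift B).opNorm_extend_le he hn
    rw [NNReal.coe_one, one_mul, ProjTensor.norm_lift] at this
    exact this.trans hB
  have eq := map_map₂_eq (n := n) (B := bilin (complTmulL 𝕜 E F)) (B' := bilin B) LinearMap.id
    LinearMap.id L.toLinearMap (fun x y => by
      change (ProjTensor.lift B).extend e (e (ProjTensor.tmul 𝕜 x y)) = B x y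
      rw [ContinuousLinearMap.extend_eq _ he hi, ProjTensor.lift_tmul]) z w
  rw [SymTensor.map_id, SymTensor.map_id] at eq
  rw [← eq]
  exact (β.fin.ext_map_le L hL _).trans (h z w)

variable (β) in
theorem preservesBanachAlgebras_iff : β.PreservesBanachAlgebras ↔ ∃ c, β.MapBound c := by
  refine ⟨fun h => β.exists_mapBound_of_bilinBound fun E F _ _ _ _ _ _ => ?_, ?_⟩
  · obtain ⟨M, -, hM⟩ := h _ (triMul (complTmulL 𝕜 E F)) (isAssocMul_triMul _)
    exact ⟨‖M‖, bilinBound_of_complTmulL hM.ext_map₂_le⟩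
  · rintro ⟨c, hc⟩ A _ _ _ m hm
    obtain ⟨M, hM, hM', -⟩ := hc.exists_mul A m hm
    exact ⟨M, hM, hM'⟩

variable (β) in
theorem algebraConstants_eq : β.algebraConstants = {c | β.MapBound c} := by
  refine Set.Subset.antisymm (fun c hc => ?_) fun c hc A _ _ _ m hm => hc.exists_mul A m hm
  have hc0 : 0 ≤ c := by
    -- The algebra of scalars has a nonzero multiplication.
    let d : ULift.{u} 𝕜 →L[𝕜] 𝕜 :=
      (ContinuousLinearEquiv.ulift : ULift.{u} 𝕜 ≃L[𝕜] 𝕜).toContinuousLinearMap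
    let m : ULift.{u} 𝕜 →L[𝕜] ULift.{u} 𝕜 →L[𝕜] ULift.{u} 𝕜 :=
      (ContinuousLinearMap.lsmul 𝕜 𝕜).comp d
    have hm1 : m ⟨1⟩ ⟨1⟩ = ⟨1⟩ := by
      change (1 : 𝕜) • (⟨1⟩ : ULift.{u} 𝕜) = ⟨1⟩
      rw [one_smul]
    have hm0 : 0 < ‖m‖ := norm_pos_iff.2 fun h0 => by
      rw [h0] at hm1
      exact zero_ne_one (congrArg ULift.down hm1)
    obtain ⟨M, -, -, hM⟩ := hc (ULift.{u} 𝕜) m fun a b t => by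
      change (a.down • b.down) • t = a.down • b.down • t
      rw [smul_eq_mul, mul_smul]
    rw [ProjTensor.norm_lift m] at hM
    exact nonneg_of_mul_nonneg_left ((norm_nonneg _).trans hM) (pow_pos hm0 n)
  refine β.mapBound_of_bilinBound hc0 fun E F _ _ _ _ _ _ G _ _ _ B hB z w => ?_
  obtain ⟨M, -, hM, hM'⟩ := hc _ (triMul B) (isAssocMul_triMul B)
  rw [ProjTensor.norm_lift, ProjTensor.norm_lift] at hM'
  refine (hM.ext_map₂_le z w).trans (mul_le_mul_of_nonneg_right (mul_le_mul_of_nonneg_right ?_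
    (β.fin.ext_nonneg z)) (β.fin.ext_nonneg w))
  exact hM'.trans (mul_le_of_le_one_right hc0
    (pow_le_one₀ (norm_nonneg _) (norm_triMul_le B hB)))

end STensorNorm

end Algebras

/-! ### The map on spaces of operators -/

section Operators

variable {𝕜 : Type} [RCLike 𝕜] {n : ℕ}

namespace STensorNorm

open SymTensor

variable (β : STensorNorm.{u} 𝕜 n) {E F G : Type u} [NormedAddCommGroup E] [NormedSpace 𝕜 E]
  [NormedAddCommGroup F] [NormedSpace 𝕜 F] [NormedAddCommGroup G] [NormedSpace 𝕜 G]

variable (𝕜 E F) in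
/-- Evaluation `(T, x) ↦ T x` as a bilinear map. -/
abbrev evalBilin : (E →L[𝕜] F) →ₗ[𝕜] E →ₗ[𝕜] F := bilin (ContinuousLinearMap.id 𝕜 (E →L[𝕜] F))

/-- `‖h‖ ≤ c` for the pair `E`, `F`. -/
def HBound (E F : Type u) [NormedAddCommGroup E] [NormedSpace 𝕜 E]
    [NormedAddCommGroup F] [NormedSpace 𝕜 F] (c : ℝ) : Prop :=
  ∀ (u : SymTensor 𝕜 n (E →L[𝕜] F)) (z : SymTensor 𝕜 n E),
    β.dual.ext F (map₂ (evalBilin 𝕜 E F) u z) ≤ c * β.dual.ext _ u * β.fin.ext E z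

variable {β}

theorem HBound.mono {c d : ℝ} (hcd : c ≤ d) (h : β.HBound E F c) : β.HBound E F d :=
  fun u z => (h u z).trans (mul_le_mul_of_nonneg_right
    (mul_le_mul_of_nonneg_right hcd (β.dual.ext_nonneg u)) (β.fin.ext_nonneg z))

theorem HBound.retract {E₀ F₀ : Type u} [NormedAddCommGroup E₀] [NormedSpace 𝕜 E₀]
    [NormedAddCommGroup F₀] [NormedSpace 𝕜 F₀] {c : ℝ} (hc : 0 ≤ c)
    (i : E₀ →L[𝕜] E) (p : E →L[𝕜] E₀) (j : F₀ →L[𝕜] F) (q : F →L[𝕜] F₀)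
    (hi : ‖i‖ ≤ 1) (hp : ‖p‖ ≤ 1) (hj : ‖j‖ ≤ 1) (hq : ‖q‖ ≤ 1) (hpi : ∀ x, p (i x) = x)
    (hqj : ∀ y, q (j y) = y) (h : β.HBound E F c) : β.HBound E₀ F₀ c := by
  intro u z
  let R : (E₀ →L[𝕜] F₀) →L[𝕜] (E →L[𝕜] F) :=
    (ContinuousLinearMap.compL 𝕜 E F₀ F j).comp ((ContinuousLinearMap.compL 𝕜 E E₀ F₀).flip p)
  have hR : ‖R‖ ≤ 1 := R.opNorm_le_bound zero_le_one fun T => by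
    change ‖j.comp (T.comp p)‖ ≤ 1 * ‖T‖
    calc ‖j.comp (T.comp p)‖ ≤ ‖j‖ * (‖T‖ * ‖p‖) := (j.opNorm_comp_le _).trans
          (mul_le_mul_of_nonneg_left (T.opNorm_comp_le p) (norm_nonneg _))
      _ ≤ 1 * (‖T‖ * 1) := by gcongr
      _ = 1 * ‖T‖ := by rw [mul_one]
  have e := map_map₂_eq (n := n) (B := evalBilin 𝕜 E₀ F₀) (B' := evalBilin 𝕜 E F)
    R.toLinearMap i.toLinearMap j.toLinearMap (fun T x => by
      change j (T x) = j (T (p (i x)))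
      rw [hpi]) u z
  have e2 : map₂ (evalBilin 𝕜 E₀ F₀) u z =
      map q.toLinearMap (map j.toLinearMap (map₂ (evalBilin 𝕜 E₀ F₀) u z)) := by
    rw [map_map, show q.toLinearMap ∘ₗ j.toLinearMap = LinearMap.id by ext y; exact hqj y, map_id]
  rw [e2, e]
  refine (β.dual.ext_map_le q hq _).trans ((h _ _).trans ?_)
  exact mul_le_mul (mul_le_mul_of_nonneg_left (β.dual.ext_map_le R hR u) hc)
    (β.fin.ext_map_le i hi z) (β.fin.ext_nonneg _) (mul_nonneg hc (β.dual.ext_nonneg _))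

/-- The bound for a bilinear map of finite-dimensional spaces, by transposition: the bracket of
`B_n(u, z)` with `w` is the bracket of `u` with the image of `(z, w)` under the map induced by the
transposed bilinear map `(x, φ) ↦ φ ∘ B(·, x)`. -/
theorem MapBound.dual_ext_map₂_le {c : ℝ} (h : β.MapBound c) [FiniteDimensional 𝕜 E]
    [FiniteDimensional 𝕜 G] (B : E →L[𝕜] F →L[𝕜] G) (hB : ‖B‖ ≤ 1) (u : SymTensor 𝕜 n E)
    (z : SymTensor 𝕜 n F) :
    β.dual.ext G (map₂ (bilin B) u z) ≤ c * β.dual.ext E u * β.fin.ext F z := by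
  refine β.dual_ext_le _ (mul_nonneg (mul_nonneg h.1 (β.dual.ext_nonneg u))
    (β.fin.ext_nonneg z)) fun w => ?_
  let B' : F →L[𝕜] StrongDual 𝕜 G →L[𝕜] StrongDual 𝕜 E :=
    (ContinuousLinearMap.compL 𝕜 E G 𝕜).flip.comp B.flip
  have hB' : ‖B'‖ ≤ 1 := B'.opNorm_le_bound₂ zero_le_one fun x φ => by
    change ‖φ.comp (B.flip x)‖ ≤ _
    have h1 : ‖B.flip x‖ ≤ 1 * ‖x‖ := B.flip.le_of_opNorm_le
      ((ContinuousLinearMap.opNorm_flip B).trans_le hB) x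
    calc ‖φ.comp (B.flip x)‖ ≤ ‖φ‖ * ‖B.flip x‖ := φ.opNorm_comp_le _
      _ ≤ ‖φ‖ * (1 * ‖x‖) := mul_le_mul_of_nonneg_left h1 (norm_nonneg _)
      _ = 1 * ‖x‖ * ‖φ‖ := by ring
  have e : pairing (map₂ (bilin B) u z) w = pairing u (map₂ (bilin B') z w) := by
    induction u using SymTensor.induction with
    | hpow T =>
      have key : (pairing (𝕜 := 𝕜) (n := n)) ∘ₗ map₂ (bilin B) (pow 𝕜 n T) =
          (map₂ (bilin B')).compr₂ (pairing (pow 𝕜 n T)) :=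
        hom_ext₂ fun x φ => by
          simp only [LinearMap.comp_apply, LinearMap.compr₂_apply, map₂_pow_pow, pairing_pow_pow]
          rfl
      exact LinearMap.congr_fun₂ key z w
    | h0 => simp
    | hadd z w hz hw => simp only [map_add, LinearMap.add_apply, hz, hw]
    | hsmul c z hz => simp only [map_smul, LinearMap.smul_apply, hz]
  rw [e]
  refine (β.norm_pairing_le_dual_mul_fin _ _).trans ?_
  calc _ ≤ β.dual.ext E u * (c * β.fin.ext F z * β.fin.ext _ w) :=
        mul_le_mul_of_nonneg_left (h.2 _ _ _ B' hB' z w) (β.dual.ext_nonneg u)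
    _ = _ := by ring

theorem MapBound.hBound {c : ℝ} (h : β.MapBound c) (E F : Type u) [NormedAddCommGroup E]
    [NormedSpace 𝕜 E] [NormedAddCommGroup F] [NormedSpace 𝕜 F] : β.HBound E F c := by
  intro u z
  refine β.fin.le_mul_ext (mul_nonneg h.1 (β.dual.ext_nonneg u)) z fun M _ z₀ hz => ?_
  rw [mul_right_comm]
  refine β.dual.le_mul_ext (mul_nonneg h.1 (β.fin.ext_nonneg z₀)) u fun K _ u₀ hu => ?_
  rw [mul_right_comm]
  -- The operators in `K` map `M` into the finite-dimensional subspace `N`.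
  let b : K →ₗ[𝕜] M →ₗ[𝕜] F := (evalBilin 𝕜 E F).compl₁₂ K.subtype M.subtype
  let N : Submodule 𝕜 F := LinearMap.range (TensorProduct.lift b)
  have hN : FiniteDimensional 𝕜 N := inferInstance
  have hmem : ∀ T x, b T x ∈ N := fun T x => ⟨T ⊗ₜ x, by simp⟩
  let B : K →L[𝕜] M →L[𝕜] N := LinearMap.mkContinuous₂
    (LinearMap.mk₂ 𝕜 (fun T x => ⟨b T x, hmem T x⟩) (fun _ _ _ => Subtype.ext (by simp))
      (fun _ _ _ => Subtype.ext (by simp)) (fun _ _ _ => Subtype.ext (by simp))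
      (fun _ _ _ => Subtype.ext (by simp))) 1 fun T x => by
      rw [one_mul]
      exact (T : E →L[𝕜] F).le_opNorm x
  have hB : ‖B‖ ≤ 1 := LinearMap.mkContinuous₂_norm_le _ zero_le_one _
  have e := map_map₂_eq (n := n) (B := bilin B) (B' := evalBilin 𝕜 E F) K.subtype M.subtype
    N.subtype (fun T x => rfl) u₀ z₀
  rw [hu, hz] at e
  rw [← e]
  exact (β.dual.ext_map_le N.subtypeL N.norm_subtypeL_le _).trans (h.dual_ext_map₂_le B hB u₀ z₀)

/-- Conversely, the bounds for `h` on `L(M, N')`, which is the dual of `M ⊗_{π₂} N`, give the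
bounds for the universal bilinear maps. -/
theorem mapBound_of_hBound {c : ℝ} (hc : 0 ≤ c)
    (h : ∀ (E F : Type u) [NormedAddCommGroup E] [NormedSpace 𝕜 E] [CompleteSpace E]
      [NormedAddCommGroup F] [NormedSpace 𝕜 F] [CompleteSpace F], β.HBound E F c) :
    β.MapBound c := by
  refine β.mapBound_of_finiteDimensional hc fun M N _ _ _ _ _ _ z w => ?_
  have := FiniteDimensional.complete 𝕜 M
  refine β.fin_ext_le _ (mul_nonneg (mul_nonneg hc (β.fin.ext_nonneg z)) (β.fin.ext_nonneg w))
    fun u => ?_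
  let Q : StrongDual 𝕜 (ProjTensor 𝕜 M N) →L[𝕜] (M →L[𝕜] StrongDual 𝕜 N) :=
    LinearMap.mkContinuous
      { toFun := fun ξ => (ContinuousLinearMap.compL 𝕜 N _ 𝕜 ξ).comp (ProjTensor.tmulL 𝕜 M N)
        map_add' := fun _ _ => rfl
        map_smul' := fun _ _ => rfl } 1 fun ξ => by
      rw [one_mul]
      refine ContinuousLinearMap.opNorm_le_bound₂ _ (norm_nonneg _) fun x y => ?_
      rw [mul_assoc]
      exact (ξ.le_opNorm _).trans
        (mul_le_mul_of_nonneg_left (ProjTensor.norm_tmul_le x y) (norm_nonneg _))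
  have hQ : ‖Q‖ ≤ 1 := LinearMap.mkContinuous_norm_le _ zero_le_one _
  have e : pairing (map₂ (bilin (ProjTensor.tmulL 𝕜 M N)) z w) u =
      pairing w (map₂ (evalBilin 𝕜 M (StrongDual 𝕜 N)) (map Q.toLinearMap u) z) := by
    induction u using SymTensor.induction with
    | hpow ξ =>
      have key : (map₂ (bilin (ProjTensor.tmulL 𝕜 M N))).compr₂ (pairing.flip (pow 𝕜 n ξ)) =
          pairing.flip ∘ₗ map₂ (evalBilin 𝕜 M (StrongDual 𝕜 N)) (map Q.toLinearMap (pow 𝕜 n ξ)) :=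
        hom_ext₂ fun x y => by
          simp only [LinearMap.comp_apply, LinearMap.compr₂_apply, map₂_pow_pow, SymTensor.map_pow,
            LinearMap.flip_apply, pairing_pow_pow]
          rfl
      exact LinearMap.congr_fun₂ key z w
    | h0 => simp
    | hadd z w hz hw => simp only [map_add, LinearMap.add_apply, hz, hw]
    | hsmul c z hz => simp only [map_smul, LinearMap.smul_apply, hz]
  rw [e]
  refine (β.norm_pairing_le_fin_mul_dual _ _).trans ?_
  calc _ ≤ β.fin.ext N w * (c * β.dual.ext _ u * β.fin.ext M z) := by
        refine mul_le_mul_of_nonneg_left ((h M (StrongDual 𝕜 N) _ z).trans ?_)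
          (β.fin.ext_nonneg w)
        exact mul_le_mul_of_nonneg_right (mul_le_mul_of_nonneg_left
          (β.dual.ext_map_le Q hQ u) hc) (β.fin.ext_nonneg z)
    _ = _ := by ring

theorem MapBound.exists_h {c : ℝ} (hc : β.MapBound c) (E F : Type u) [NormedAddCommGroup E]
    [NormedSpace 𝕜 E] [NormedAddCommGroup F] [NormedSpace 𝕜 F] :
    ∃ h : β.dual.Space (E →L[𝕜] F) →L[𝕜] (β.fin.Space E →L[𝕜] β.dual.Space F),
      β.IsNaturalH h ∧ ‖h‖ ≤ c :=
  ⟨FinSTensorNorm.spaceMap₂ _ _ _ _ c (hc.hBound E F), fun _ _ =>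
    FinSTensorNorm.spaceMap₂_pow _ _ _, FinSTensorNorm.norm_spaceMap₂_le _ hc.1⟩

theorem IsNaturalH.hBound {h : β.dual.Space (E →L[𝕜] F) →L[𝕜]
    (β.fin.Space E →L[𝕜] β.dual.Space F)} (hh : β.IsNaturalH h) : β.HBound E F ‖h‖ := by
  intro u z
  have key : bilin h = ((map₂ (evalBilin 𝕜 E F)).compr₂ β.dual.toSpace.toLinearMap).compl₁₂
      β.dual.toSpace.symm.toLinearMap β.fin.toSpace.symm.toLinearMap :=
    FinSTensorNorm.space_hom_ext fun T => FinSTensorNorm.space_hom_ext fun x =>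
      (hh T x).trans (congrArg β.dual.toSpace (map₂_pow_pow (evalBilin 𝕜 E F) T x).symm)
  have key' : h (β.dual.toSpace u) (β.fin.toSpace z) =
      β.dual.toSpace (map₂ (evalBilin 𝕜 E F) u z) :=
    LinearMap.congr_fun₂ key (β.dual.toSpace u) (β.fin.toSpace z)
  rw [← FinSTensorNorm.norm_toSpace, ← key']
  exact h.le_opNorm₂ _ _

variable (β) in
theorem hasNaturalH_iff : β.HasNaturalH ↔ ∃ c, β.MapBound c := by
  refine ⟨fun H => ?_, ?_⟩
  · obtain ⟨c, hc, hc'⟩ := exists_uniform_of_retract (𝕜 := 𝕜)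
      (fun E F _ _ _ _ _ _ c => 0 ≤ c ∧ β.HBound E F c)
      (fun E F _ _ _ _ _ _ c d hcd h => ⟨h.1.trans hcd, h.2.mono hcd⟩)
      (fun E₀ F₀ E F _ _ _ _ _ _ _ _ _ _ _ _ i p j q hi hp hj hq hpi hqj c hc =>
        ⟨hc.1, hc.2.retract hc.1 i p j q hi hp hj hq hpi hqj⟩)
      (fun E F _ _ _ _ _ _ => by
        obtain ⟨h, hh⟩ := H E F
        exact ⟨‖h‖, norm_nonneg h, hh.hBound⟩)
    exact ⟨c, mapBound_of_hBound hc fun E F _ _ _ _ _ _ => (hc' E F).2⟩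
  · rintro ⟨c, hc⟩ E F _ _ _ _ _ _
    obtain ⟨h, hh, -⟩ := hc.exists_h E F
    exact ⟨h, hh⟩

variable (β) in
theorem hConstants_eq : β.hConstants = {c | β.MapBound c} := by
  refine Set.Subset.antisymm (fun c hc => ?_) fun c hc E F _ _ _ _ _ _ => hc.exists_h E F
  have hc0 : 0 ≤ c := by
    obtain ⟨h, -, hh⟩ := hc PUnit PUnit
    exact (norm_nonneg h).trans hh
  refine mapBound_of_hBound hc0 fun E F _ _ _ _ _ _ => ?_
  obtain ⟨h, hh, hh'⟩ := hc E F
  exact hh.hBound.mono hh'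

end STensorNorm

end Operators

/-! ### The map on injective tensor products -/

section Injective

variable {𝕜 : Type} [RCLike 𝕜] {n : ℕ}
  {E F E' F' : Type u} [NormedAddCommGroup E] [NormedSpace 𝕜 E]
  [NormedAddCommGroup F] [NormedSpace 𝕜 F] [NormedAddCommGroup E'] [NormedSpace 𝕜 E']
  [NormedAddCommGroup F'] [NormedSpace 𝕜 F']

theorem dualDistrib_map {E F E' F' : Type u} [AddCommGroup E] [Module 𝕜 E] [AddCommGroup F]
    [Module 𝕜 F] [AddCommGroup E'] [Module 𝕜 E'] [AddCommGroup F'] [Module 𝕜 F']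
    (S : E →ₗ[𝕜] E') (T : F →ₗ[𝕜] F') (φ : E' →ₗ[𝕜] 𝕜) (ψ : F' →ₗ[𝕜] 𝕜)
    (t : E ⊗[𝕜] F) : TensorProduct.dualDistrib 𝕜 E' F' (φ ⊗ₜ ψ) (TensorProduct.map S T t) =
      TensorProduct.dualDistrib 𝕜 E F ((φ ∘ₗ S) ⊗ₜ (ψ ∘ₗ T)) t := by
  induction t using TensorProduct.induction_on with
  | zero => simp
  | tmul x y => simp
  | add s t hs ht => rw [map_add, map_add, map_add, hs, ht]

namespace InjTensor

instance [FiniteDimensional 𝕜 E] [FiniteDimensional 𝕜 F] :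
    FiniteDimensional 𝕜 (InjTensor 𝕜 E F) :=
  inferInstanceAs (FiniteDimensional 𝕜 (E ⊗[𝕜] F))

theorem injNorm₂_map_le (S : E →L[𝕜] E') (T : F →L[𝕜] F') (hS : ‖S‖ ≤ 1) (hT : ‖T‖ ≤ 1)
    (t : E ⊗[𝕜] F) :
    injNorm₂ (TensorProduct.map S.toLinearMap T.toLinearMap t) ≤ injNorm₂ t := by
  refine injNorm₂_le _ _ fun φ ψ hφ hψ => ?_
  rw [dualDistrib_map]
  exact norm_dualDistrib_le_injNorm₂ t (φ.comp S) (ψ.comp T)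
    ((φ.opNorm_comp_le S).trans (mul_le_one₀ hφ (norm_nonneg _) hS))
    ((ψ.opNorm_comp_le T).trans (mul_le_one₀ hψ (norm_nonneg _) hT))

/-- The injective norm respects subspaces, by the Hahn–Banach theorem. -/
theorem injNorm₂_le_map_subtype (M : Submodule 𝕜 E) (N : Submodule 𝕜 F) (t : M ⊗[𝕜] N) :
    injNorm₂ t ≤ injNorm₂ (TensorProduct.map M.subtype N.subtype t) := by
  refine injNorm₂_le _ _ fun φ ψ hφ hψ => ?_
  obtain ⟨φ', h1, h1'⟩ := exists_extension_norm_eq M φ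
  obtain ⟨ψ', h2, h2'⟩ := exists_extension_norm_eq N ψ
  have e1 : φ.toLinearMap = φ'.toLinearMap ∘ₗ M.subtype := LinearMap.ext fun x => (h1 x).symm
  have e2 : ψ.toLinearMap = ψ'.toLinearMap ∘ₗ N.subtype := LinearMap.ext fun x => (h2 x).symm
  rw [e1, e2, ← dualDistrib_map]
  exact norm_dualDistrib_le_injNorm₂ _ _ _ (h1'.trans_le hφ) (h2'.trans_le hψ)

/-- Functionals of the form `φ ⊗ ψ` on the injective tensor product have norm at most
`‖φ‖ ‖ψ‖`. -/
theorem norm_dualDistrib_le (φ : StrongDual 𝕜 E) (ψ : StrongDual 𝕜 F) (t : E ⊗[𝕜] F) :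
    ‖TensorProduct.dualDistrib 𝕜 E F (φ.toLinearMap ⊗ₜ ψ.toLinearMap) t‖ ≤
      ‖φ‖ * ‖ψ‖ * injNorm₂ t := by
  obtain ⟨φ', hφ, e1⟩ := exists_eq_norm_smul (𝕜 := 𝕜) φ
  obtain ⟨ψ', hψ, e2⟩ := exists_eq_norm_smul (𝕜 := 𝕜) ψ
  have e : φ.toLinearMap ⊗ₜ[𝕜] ψ.toLinearMap =
      ((‖φ‖ : 𝕜) * (‖ψ‖ : 𝕜)) • (φ'.toLinearMap ⊗ₜ[𝕜] ψ'.toLinearMap) := by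
    rw [← TensorProduct.smul_tmul_smul]
    conv_lhs => rw [e1, e2]
    rfl
  rw [e, map_smul, LinearMap.smul_apply, norm_smul, norm_mul, RCLike.norm_ofReal,
    RCLike.norm_ofReal, abs_norm, abs_norm]
  exact mul_le_mul_of_nonneg_left (norm_dualDistrib_le_injNorm₂ t φ' ψ' hφ hψ) (by positivity)

/-- The tensor product of two contractions, as a contraction of injective tensor products. -/
def map (S : E →L[𝕜] E') (T : F →L[𝕜] F') (hS : ‖S‖ ≤ 1) (hT : ‖T‖ ≤ 1) :
    InjTensor 𝕜 E F →L[𝕜] InjTensor 𝕜 E' F' :=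
  LinearMap.mkContinuous ((of 𝕜 E' F').toLinearMap ∘ₗ
    TensorProduct.map S.toLinearMap T.toLinearMap ∘ₗ (of 𝕜 E F).symm.toLinearMap) 1 fun t => by
      rw [one_mul]
      exact injNorm₂_map_le S T hS hT ((of 𝕜 E F).symm t)

theorem norm_map_le (S : E →L[𝕜] E') (T : F →L[𝕜] F') (hS : ‖S‖ ≤ 1) (hT : ‖T‖ ≤ 1) :
    ‖map S T hS hT‖ ≤ 1 := LinearMap.mkContinuous_norm_le _ zero_le_one _

theorem norm_map_apply_le (S : E →L[𝕜] E') (T : F →L[𝕜] F') (hS : ‖S‖ ≤ 1) (hT : ‖T‖ ≤ 1)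
    (t : InjTensor 𝕜 E F) : ‖map S T hS hT t‖ ≤ ‖t‖ :=
  injNorm₂_map_le S T hS hT ((of 𝕜 E F).symm t)

/-- The functional `φ ⊗ ψ` on `E ⊗_{ε₂} F`, as a bounded bilinear expression in `φ` and `ψ`. -/
def dualTensor : StrongDual 𝕜 E →L[𝕜] StrongDual 𝕜 F →L[𝕜] StrongDual 𝕜 (InjTensor 𝕜 E F) :=
  LinearMap.mkContinuous₂ (LinearMap.mk₂ 𝕜
    (fun φ ψ => LinearMap.mkContinuous (TensorProduct.dualDistrib 𝕜 E F
      (φ.toLinearMap ⊗ₜ ψ.toLinearMap) ∘ₗ (of 𝕜 E F).symm.toLinearMap) (‖φ‖ * ‖ψ‖)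
        fun t => norm_dualDistrib_le φ ψ ((of 𝕜 E F).symm t))
    (fun φ φ' ψ => by ext t; simp [TensorProduct.add_tmul])
    (fun c φ ψ => by ext t; simp [← TensorProduct.smul_tmul'])
    (fun φ ψ ψ' => by ext t; simp [TensorProduct.tmul_add])
    (fun c φ ψ => by ext t; simp)) 1
    fun φ ψ => by
      rw [one_mul]
      exact LinearMap.mkContinuous_norm_le _ (by positivity)
        fun t => norm_dualDistrib_le φ ψ ((of 𝕜 E F).symm t)

theorem norm_dualTensor_le : ‖dualTensor (𝕜 := 𝕜) (E := E) (F := F)‖ ≤ 1 :=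
  LinearMap.mkContinuous₂_norm_le _ zero_le_one _

/-- A finite-dimensional subspace of `E ⊗_{ε₂} F` embeds isometrically into `M ⊗_{ε₂} N` for
suitable finite-dimensional subspaces `M` and `N`. -/
theorem exists_finiteDimensional_contraction (K : Submodule 𝕜 (InjTensor 𝕜 E F))
    [FiniteDimensional 𝕜 K] : ∃ (M : Submodule 𝕜 E) (N : Submodule 𝕜 F)
      (_ : FiniteDimensional 𝕜 M) (_ : FiniteDimensional 𝕜 N) (S : K →L[𝕜] InjTensor 𝕜 M N),
      ‖S‖ ≤ 1 ∧ ∀ k, map M.subtypeL N.subtypeL M.norm_subtypeL_le N.norm_subtypeL_le (S k) = k := by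
  obtain ⟨s, hs⟩ := Submodule.fg_iff_finiteDimensional K |>.2 inferInstance
  obtain ⟨M, N, hM, hN, h⟩ := TensorProduct.exists_finite_submodule_of_setFinite (R := 𝕜) (M := E)
    (N := F) (s : Set (InjTensor 𝕜 E F)) s.finite_toSet
  let j : M ⊗[𝕜] N →ₗ[𝕜] InjTensor 𝕜 E F :=
    (of 𝕜 E F).toLinearMap ∘ₗ TensorProduct.map M.subtype N.subtype
  have hj : Function.Injective j :=
    TensorProduct.map_injective_of_flat_flat _ _ M.subtype_injective N.subtype_injective
  have hK : K ≤ LinearMap.range j := by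
    rw [← hs, Submodule.span_le]
    exact h
  let S₀ : K →ₗ[𝕜] M ⊗[𝕜] N :=
    (LinearEquiv.ofInjective j hj).symm.toLinearMap ∘ₗ Submodule.inclusion hK
  have hS₀ : ∀ k, j (S₀ k) = k := fun k =>
    congrArg Subtype.val
      ((LinearEquiv.ofInjective j hj).apply_symm_apply (Submodule.inclusion hK k))
  refine ⟨M, N, hM, hN, LinearMap.mkContinuous ((of 𝕜 M N).toLinearMap ∘ₗ S₀) 1 fun k => ?_,
    LinearMap.mkContinuous_norm_le _ zero_le_one _, hS₀⟩
  rw [one_mul]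
  refine (injNorm₂_le_map_subtype M N (S₀ k)).trans (le_of_eq ?_)
  change ‖j (S₀ k)‖ = ‖k‖
  rw [hS₀]
  rfl

end InjTensor

namespace FinSTensorNorm

open SymTensor

variable (α : FinSTensorNorm.{u} 𝕜 n)

variable (E F) in
/-- The natural map `⊗^{n,s} (E ⊗_{ε₂} F) → (⊗^{n,s}_α E) ⊗_{ε₂} (⊗^{n,s}_α F)`, without any
assertion about its continuity. -/
def splitInj : SymTensor 𝕜 n (InjTensor 𝕜 E F) →ₗ[𝕜] InjTensor 𝕜 (α.Space E) (α.Space F) :=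
  (InjTensor.of 𝕜 _ _).toLinearMap ∘ₗ
    TensorProduct.map (α.toSpace (E := E)).toLinearMap (α.toSpace (E := F)).toLinearMap ∘ₗ
      split 𝕜 n E F ∘ₗ SymTensor.map (InjTensor.of 𝕜 E F).symm.toLinearMap

theorem splitInj_symProd (x : Fin n → E) (y : Fin n → F) :
    α.splitInj E F (SymTensor.symProd fun i => InjTensor.tmul 𝕜 (x i) (y i)) =
      InjTensor.tmul 𝕜 (α.symProd x) (α.symProd y) := by
  have h := split_symProd (𝕜 := 𝕜) x y
  simp only [splitInj, LinearMap.comp_apply, map_symProd]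
  change InjTensor.of 𝕜 _ _ (TensorProduct.map _ _
    (split 𝕜 n E F (SymTensor.symProd fun i => x i ⊗ₜ y i))) = _
  rw [h]
  rfl

theorem splitInj_map (S : E →L[𝕜] E') (T : F →L[𝕜] F') (hS : ‖S‖ ≤ 1) (hT : ‖T‖ ≤ 1)
    (u : SymTensor 𝕜 n (InjTensor 𝕜 E F)) :
    α.splitInj E' F' (SymTensor.map (InjTensor.map S T hS hT).toLinearMap u) =
      InjTensor.map (α.spaceMap S hS) (α.spaceMap T hT) (α.norm_spaceMap_le S hS)
        (α.norm_spaceMap_le T hT) (α.splitInj E F u) := by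
  have e := split_map S.toLinearMap T.toLinearMap
    (SymTensor.map (InjTensor.of 𝕜 E F).symm.toLinearMap u)
  rw [map_map] at e
  simp only [splitInj, LinearMap.comp_apply, map_map]
  change InjTensor.of 𝕜 _ _ (TensorProduct.map _ _ (split 𝕜 n E' F' (SymTensor.map
    (TensorProduct.map S.toLinearMap T.toLinearMap ∘ₗ (InjTensor.of 𝕜 E F).symm.toLinearMap) u))) =
    InjTensor.of 𝕜 _ _ (TensorProduct.map _ _ (TensorProduct.map _ _
      (split 𝕜 n E F (SymTensor.map (InjTensor.of 𝕜 E F).symm.toLinearMap u))))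
  rw [e]
  generalize split 𝕜 n E F (SymTensor.map (InjTensor.of 𝕜 E F).symm.toLinearMap u) = s
  congr 1
  induction s using TensorProduct.induction_on with
  | zero => simp only [map_zero]
  | tmul a b => rfl
  | add s t hs ht => simp only [map_add, hs, ht]

end FinSTensorNorm

namespace STensorNorm

open SymTensor

variable (β : STensorNorm.{u} 𝕜 n)

/-- `‖g‖ ≤ c` for the pair `E`, `F`. -/
def GBound (E F : Type u) [NormedAddCommGroup E] [NormedSpace 𝕜 E]
    [NormedAddCommGroup F] [NormedSpace 𝕜 F] (c : ℝ) : Prop :=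
  ∀ u : SymTensor 𝕜 n (InjTensor 𝕜 E F), ‖β.dual.splitInj E F u‖ ≤ c * β.dual.ext _ u

variable {β}

theorem GBound.mono {c d : ℝ} (hcd : c ≤ d) (h : β.GBound E F c) : β.GBound E F d :=
  fun u => (h u).trans (mul_le_mul_of_nonneg_right hcd (β.dual.ext_nonneg u))

theorem GBound.retract {E₀ F₀ : Type u} [NormedAddCommGroup E₀] [NormedSpace 𝕜 E₀]
    [NormedAddCommGroup F₀] [NormedSpace 𝕜 F₀] {c : ℝ} (hc : 0 ≤ c)
    (i : E₀ →L[𝕜] E) (p : E →L[𝕜] E₀) (j : F₀ →L[𝕜] F) (q : F →L[𝕜] F₀)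
    (hi : ‖i‖ ≤ 1) (hp : ‖p‖ ≤ 1) (hj : ‖j‖ ≤ 1) (hq : ‖q‖ ≤ 1) (hpi : ∀ x, p (i x) = x)
    (hqj : ∀ y, q (j y) = y) (h : β.GBound E F c) : β.GBound E₀ F₀ c := by
  intro u
  have e : SymTensor.map (InjTensor.map p q hp hq).toLinearMap
      (SymTensor.map (InjTensor.map i j hi hj).toLinearMap u) = u := by
    rw [map_map]
    convert map_id u
    refine TensorProduct.ext' fun x y => ?_
    change p (i x) ⊗ₜ[𝕜] q (j y) = x ⊗ₜ[𝕜] y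
    rw [hpi, hqj]
  rw [← e, β.dual.splitInj_map]
  refine (InjTensor.norm_map_apply_le _ _ _ _ _).trans ?_
  rw [e]
  exact (h _).trans (mul_le_mul_of_nonneg_left
    (β.dual.ext_map_le _ (InjTensor.norm_map_le i j hi hj) u) hc)

/-- The natural map on injective tensor products is adjoint to the map induced by
`(φ, ψ) ↦ φ ⊗ ψ`. -/
theorem dualDistrib_split_pairing (u : SymTensor 𝕜 n (InjTensor 𝕜 E F))
    (z : SymTensor 𝕜 n (StrongDual 𝕜 E)) (w : SymTensor 𝕜 n (StrongDual 𝕜 F)) :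
    TensorProduct.dualDistrib 𝕜 _ _ (pairing.flip z ⊗ₜ pairing.flip w)
      (split 𝕜 n E F (SymTensor.map (InjTensor.of 𝕜 E F).symm.toLinearMap u)) =
      pairing u (map₂ (bilin InjTensor.dualTensor) z w) := by
  induction u using SymTensor.induction with
  | hpow t =>
    have key : ((TensorProduct.mk 𝕜 _ _).compl₁₂ (pairing (E := E)).flip
        (pairing (𝕜 := 𝕜) (n := n) (E := F)).flip).compr₂
        ((TensorProduct.dualDistrib 𝕜 _ _).flip (split 𝕜 n E F
          (SymTensor.map (InjTensor.of 𝕜 E F).symm.toLinearMap (pow 𝕜 n t)))) =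
        (map₂ (bilin InjTensor.dualTensor)).compr₂ (pairing (pow 𝕜 n t)) :=
      hom_ext₂ fun φ ψ => by
        simp only [LinearMap.compr₂_apply, LinearMap.compl₁₂_apply, TensorProduct.mk_apply,
          LinearMap.flip_apply, map₂_pow_pow, pairing_pow_pow, SymTensor.map_pow]
        exact dualDistrib_split_pow _ _ φ.toLinearMap ψ.toLinearMap (fun x => by simp)
          (fun y => by simp) _
    exact LinearMap.congr_fun₂ key z w
  | h0 => simp
  | hadd z w hz hw => simp only [map_add, LinearMap.add_apply, hz, hw]
  | hsmul c z hz => simp only [map_smul, LinearMap.smul_apply, hz]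

theorem MapBound.gBound_of_finiteDimensional {c : ℝ} (h : β.MapBound c) [FiniteDimensional 𝕜 E]
    [FiniteDimensional 𝕜 F] : β.GBound E F c := by
  intro u
  have hcu := mul_nonneg h.1 (β.dual.ext_nonneg u)
  refine injNorm₂_le _ _ fun Φ Ψ hΦ hΨ => ?_
  obtain ⟨z, hz, hz'⟩ := β.exists_pairing_of_dual Φ
  obtain ⟨w, hw, hw'⟩ := β.exists_pairing_of_dual Ψ
  have e1 : Φ.toLinearMap ∘ₗ β.dual.toSpace.toLinearMap = pairing.flip z := LinearMap.ext hz
  have e2 : Ψ.toLinearMap ∘ₗ β.dual.toSpace.toLinearMap = pairing.flip w := LinearMap.ext hw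
  have e := dualDistrib_map (β.dual.toSpace (E := E)).toLinearMap
    (β.dual.toSpace (E := F)).toLinearMap Φ.toLinearMap Ψ.toLinearMap
    (split 𝕜 n E F (SymTensor.map (InjTensor.of 𝕜 E F).symm.toLinearMap u))
  rw [e1, e2, dualDistrib_split_pairing] at e
  refine (congrArg _ e).trans_le ((β.norm_pairing_le_dual_mul_fin _ _).trans ?_)
  calc _ ≤ β.dual.ext _ u * (c * β.fin.ext _ z * β.fin.ext _ w) :=
        mul_le_mul_of_nonneg_left (h.2 _ _ _ _ InjTensor.norm_dualTensor_le z w)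
          (β.dual.ext_nonneg u)
    _ ≤ β.dual.ext _ u * (c * 1 * 1) := by
        refine mul_le_mul_of_nonneg_left ?_ (β.dual.ext_nonneg u)
        exact mul_le_mul (mul_le_mul_of_nonneg_left (hz'.trans hΦ) h.1) (hw'.trans hΨ)
          (β.fin.ext_nonneg w) (mul_nonneg h.1 zero_le_one)
    _ = c * β.dual.ext _ u := by ring

theorem MapBound.gBound {c : ℝ} (h : β.MapBound c) (E F : Type u) [NormedAddCommGroup E]
    [NormedSpace 𝕜 E] [NormedAddCommGroup F] [NormedSpace 𝕜 F] : β.GBound E F c := by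
  intro u
  refine β.dual.le_mul_ext h.1 u fun K _ u₀ hu => ?_
  obtain ⟨M, N, hM, hN, S, hS, hS'⟩ := InjTensor.exists_finiteDimensional_contraction K
  have e : SymTensor.map (InjTensor.map M.subtypeL N.subtypeL M.norm_subtypeL_le
      N.norm_subtypeL_le).toLinearMap (SymTensor.map S.toLinearMap u₀) = u := by
    rw [map_map, ← hu]
    congr 2
    exact LinearMap.ext hS'
  rw [← e, β.dual.splitInj_map]
  refine (InjTensor.norm_map_apply_le _ _ _ _ _).trans ?_
  exact (h.gBound_of_finiteDimensional _).trans
    (mul_le_mul_of_nonneg_left (β.dual.ext_map_le S hS u₀) h.1)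

section Converse

variable {M N : Type u} [NormedAddCommGroup M] [NormedSpace 𝕜 M] [NormedAddCommGroup N]
  [NormedSpace 𝕜 N] [FiniteDimensional 𝕜 M] [FiniteDimensional 𝕜 N]

variable (𝕜 M N) in
/-- For finite-dimensional `M` and `N`, the tensor in `M' ⊗ N'` that represents a functional on
`M ⊗ N`. -/
def tensorOfDual : StrongDual 𝕜 (ProjTensor 𝕜 M N) →ₗ[𝕜] StrongDual 𝕜 M ⊗[𝕜] StrongDual 𝕜 N :=
  TensorProduct.map (LinearMap.toContinuousLinearMap (E := M) (F' := 𝕜)).toLinearMap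
      (LinearMap.toContinuousLinearMap (E := N) (F' := 𝕜)).toLinearMap ∘ₗ
    (TensorProduct.dualDistribEquiv 𝕜 M N).symm.toLinearMap ∘ₗ
    (ProjTensor.of 𝕜 M N).toLinearMap.dualMap ∘ₗ ContinuousLinearMap.coeLM 𝕜

theorem dualDistrib_tensorOfDual (ξ : StrongDual 𝕜 (ProjTensor 𝕜 M N)) (x : M) (y : N) :
    TensorProduct.dualDistrib 𝕜 _ _ ((toBidual 𝕜 M x).toLinearMap ⊗ₜ (toBidual 𝕜 N y).toLinearMap)
      (tensorOfDual 𝕜 M N ξ) = ξ (ProjTensor.tmul 𝕜 x y) := by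
  have aux : ∀ s : Module.Dual 𝕜 M ⊗[𝕜] Module.Dual 𝕜 N,
      TensorProduct.dualDistrib 𝕜 _ _
        ((toBidual 𝕜 M x).toLinearMap ⊗ₜ (toBidual 𝕜 N y).toLinearMap)
        (TensorProduct.map (LinearMap.toContinuousLinearMap (E := M) (F' := 𝕜)).toLinearMap
          (LinearMap.toContinuousLinearMap (E := N) (F' := 𝕜)).toLinearMap s) =
        TensorProduct.dualDistrib 𝕜 M N s (x ⊗ₜ y) := by
    intro s
    induction s using TensorProduct.induction_on with
    | zero => simp
    | tmul φ ψ => simp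
    | add s t hs ht => simp only [map_add, LinearMap.add_apply, hs, ht]
  refine (aux _).trans ?_
  have h := (TensorProduct.dualDistribEquiv 𝕜 M N).apply_symm_apply
    ((ProjTensor.of 𝕜 M N).toLinearMap.dualMap (ContinuousLinearMap.coeLM 𝕜 ξ))
  exact LinearMap.congr_fun h (x ⊗ₜ y)

theorem injNorm₂_tensorOfDual_le (ξ : StrongDual 𝕜 (ProjTensor 𝕜 M N)) :
    injNorm₂ (tensorOfDual 𝕜 M N ξ) ≤ ‖ξ‖ := by
  refine injNorm₂_le _ _ fun Φ Ψ hΦ hΨ => ?_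
  have h := dualDistrib_tensorOfDual ξ (ofBidual 𝕜 M Φ) (ofBidual 𝕜 N Ψ)
  rw [toBidual_ofBidual, toBidual_ofBidual] at h
  rw [h]
  have h1 := (ofBidual 𝕜 M).le_of_opNorm_le_of_le norm_ofBidual_le hΦ
  have h2 := (ofBidual 𝕜 N).le_of_opNorm_le_of_le norm_ofBidual_le hΨ
  rw [one_mul] at h1 h2
  refine (ξ.le_opNorm _).trans (mul_le_of_le_one_right (norm_nonneg _) ?_)
  exact (ProjTensor.norm_tmul_le _ _).trans (mul_le_one₀ h1 (norm_nonneg _) h2)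

variable (𝕜 M N) in
/-- The contraction `(M ⊗_{π₂} N)' → M' ⊗_{ε₂} N'` for finite-dimensional `M` and `N`. -/
def injTensorOfDual : StrongDual 𝕜 (ProjTensor 𝕜 M N) →L[𝕜]
    InjTensor 𝕜 (StrongDual 𝕜 M) (StrongDual 𝕜 N) :=
  LinearMap.mkContinuous ((InjTensor.of 𝕜 _ _).toLinearMap ∘ₗ tensorOfDual 𝕜 M N) 1 fun ξ => by
    rw [one_mul]
    exact injNorm₂_tensorOfDual_le ξ

theorem norm_injTensorOfDual_le : ‖injTensorOfDual 𝕜 M N‖ ≤ 1 :=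
  LinearMap.mkContinuous_norm_le _ zero_le_one _

theorem pairing_map₂_tmulL (z : SymTensor 𝕜 n M) (w : SymTensor 𝕜 n N)
    (u : SymTensor 𝕜 n (StrongDual 𝕜 (ProjTensor 𝕜 M N))) :
    pairing (map₂ (bilin (ProjTensor.tmulL 𝕜 M N)) z w) u =
      TensorProduct.dualDistrib 𝕜 _ _ (pairing z ⊗ₜ pairing w)
        (split 𝕜 n _ _ (SymTensor.map (InjTensor.of 𝕜 _ _).symm.toLinearMap
          (SymTensor.map (injTensorOfDual 𝕜 M N).toLinearMap u))) := by
  induction u using SymTensor.induction with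
  | hpow ξ =>
    have key : (map₂ (bilin (ProjTensor.tmulL 𝕜 M N))).compr₂ (pairing.flip (pow 𝕜 n ξ)) =
        ((TensorProduct.mk 𝕜 _ _).compl₁₂ (pairing (𝕜 := 𝕜) (n := n) (E := M))
        (pairing (𝕜 := 𝕜) (n := n) (E := N))).compr₂
        ((TensorProduct.dualDistrib 𝕜 _ _).flip (split 𝕜 n _ _
          (SymTensor.map (InjTensor.of 𝕜 _ _).symm.toLinearMap
          (SymTensor.map (injTensorOfDual 𝕜 M N).toLinearMap (pow 𝕜 n ξ))))) :=
      hom_ext₂ fun x y => by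
        simp only [LinearMap.compr₂_apply, LinearMap.compl₁₂_apply, TensorProduct.mk_apply,
          LinearMap.flip_apply, map₂_pow_pow, pairing_pow_pow, SymTensor.map_pow]
        refine Eq.symm ((dualDistrib_split_pow _ _ (toBidual 𝕜 M x).toLinearMap
          (toBidual 𝕜 N y).toLinearMap (fun x => by simp) (fun y => by simp) _).trans ?_)
        exact congrArg (· ^ n) (dualDistrib_tensorOfDual ξ x y)
    exact LinearMap.congr_fun₂ key z w
  | h0 => simp
  | hadd z w hz hw => simp only [map_add, hz, hw]
  | hsmul c z hz => simp only [map_smul, hz]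

variable (β) in
/-- The functional on `⊗^{n,s}_{β'} M'` given by an element of `⊗^{n,s}_β M`. -/
def dualFunctional (z : SymTensor 𝕜 n M) : StrongDual 𝕜 (β.dual.Space (StrongDual 𝕜 M)) :=
  LinearMap.mkContinuous (pairing z ∘ₗ β.dual.toSpace.symm.toLinearMap) (β.fin.ext M z)
    fun u => β.norm_pairing_le_fin_mul_dual z (β.dual.toSpace.symm u)

theorem norm_dualFunctional_le (z : SymTensor 𝕜 n M) :
    ‖β.dualFunctional z‖ ≤ β.fin.ext M z :=
  LinearMap.mkContinuous_norm_le _ (β.fin.ext_nonneg z) _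

end Converse

/-- Conversely, the bounds for `g` on `M' ⊗_{ε₂} N'`, which is the dual of `M ⊗_{π₂} N`, give the
bounds for the universal bilinear maps. -/
theorem mapBound_of_gBound {c : ℝ} (hc : 0 ≤ c)
    (h : ∀ (E F : Type u) [NormedAddCommGroup E] [NormedSpace 𝕜 E] [CompleteSpace E]
      [NormedAddCommGroup F] [NormedSpace 𝕜 F] [CompleteSpace F], β.GBound E F c) :
    β.MapBound c := by
  refine β.mapBound_of_finiteDimensional hc fun M N _ _ _ _ _ _ z w => ?_
  refine β.fin_ext_le _ (mul_nonneg (mul_nonneg hc (β.fin.ext_nonneg z)) (β.fin.ext_nonneg w))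
    fun u => ?_
  rw [pairing_map₂_tmulL]
  have e := dualDistrib_map (β.dual.toSpace (E := StrongDual 𝕜 M)).toLinearMap
    (β.dual.toSpace (E := StrongDual 𝕜 N)).toLinearMap (β.dualFunctional z).toLinearMap
    (β.dualFunctional w).toLinearMap (split 𝕜 n _ _ (SymTensor.map
      (InjTensor.of 𝕜 _ _).symm.toLinearMap
        (SymTensor.map (injTensorOfDual 𝕜 M N).toLinearMap u)))
  refine (congrArg (‖·‖) e.symm).trans_le
    ((InjTensor.norm_dualDistrib_le (β.dualFunctional z) (β.dualFunctional w) _).trans ?_)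
  have h1 := h (StrongDual 𝕜 M) (StrongDual 𝕜 N) (SymTensor.map
    (injTensorOfDual 𝕜 M N).toLinearMap u)
  have h2 := β.dual.ext_map_le (injTensorOfDual 𝕜 M N) norm_injTensorOfDual_le u
  calc _ ≤ β.fin.ext M z * β.fin.ext N w * (c * β.dual.ext _ u) :=
        mul_le_mul (mul_le_mul (norm_dualFunctional_le z) (norm_dualFunctional_le w)
          (norm_nonneg _) (β.fin.ext_nonneg z)) (h1.trans (mul_le_mul_of_nonneg_left h2 hc))
          (norm_nonneg _) (mul_nonneg (β.fin.ext_nonneg z) (β.fin.ext_nonneg w))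
    _ = _ := by ring

theorem MapBound.exists_g {c : ℝ} (hc : β.MapBound c) (E F : Type u) [NormedAddCommGroup E]
    [NormedSpace 𝕜 E] [NormedAddCommGroup F] [NormedSpace 𝕜 F] :
    ∃ g : β.dual.Space (InjTensor 𝕜 E F) →L[𝕜] InjTensor 𝕜 (β.dual.Space E) (β.dual.Space F),
      β.IsNaturalG g ∧ ‖g‖ ≤ c :=
  ⟨LinearMap.mkContinuous (β.dual.splitInj E F ∘ₗ β.dual.toSpace.symm.toLinearMap) c
    fun u => hc.gBound E F (β.dual.toSpace.symm u), β.dual.splitInj_symProd,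
    LinearMap.mkContinuous_norm_le _ hc.1 _⟩

theorem IsNaturalG.gBound {g : β.dual.Space (InjTensor 𝕜 E F) →L[𝕜]
    InjTensor 𝕜 (β.dual.Space E) (β.dual.Space F)} (hg : β.IsNaturalG g) :
    β.GBound E F ‖g‖ := by
  intro u
  have key : g.toLinearMap ∘ₗ β.dual.toSpace.toLinearMap = β.dual.splitInj E F :=
    hom_ext_symProd_tmul (E := E) (F := F) fun x y =>
      (hg x y).trans (β.dual.splitInj_symProd x y).symm
  rw [← key]
  exact g.le_opNorm _

variable (β) in
theorem hasNaturalG_iff : β.HasNaturalG ↔ ∃ c, β.MapBound c := by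
  refine ⟨fun H => ?_, ?_⟩
  · obtain ⟨c, hc, hc'⟩ := exists_uniform_of_retract (𝕜 := 𝕜)
      (fun E F _ _ _ _ _ _ c => 0 ≤ c ∧ β.GBound E F c)
      (fun E F _ _ _ _ _ _ c d hcd h => ⟨h.1.trans hcd, h.2.mono hcd⟩)
      (fun E₀ F₀ E F _ _ _ _ _ _ _ _ _ _ _ _ i p j q hi hp hj hq hpi hqj c hc =>
        ⟨hc.1, hc.2.retract hc.1 i p j q hi hp hj hq hpi hqj⟩)
      (fun E F _ _ _ _ _ _ => by
        obtain ⟨g, hg⟩ := H E F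
        exact ⟨‖g‖, norm_nonneg g, hg.gBound⟩)
    exact ⟨c, mapBound_of_gBound hc fun E F _ _ _ _ _ _ => (hc' E F).2⟩
  · rintro ⟨c, hc⟩ E F _ _ _ _ _ _
    obtain ⟨g, hg, -⟩ := hc.exists_g E F
    exact ⟨g, hg⟩

variable (β) in
theorem gConstants_eq : β.gConstants = {c | β.MapBound c} := by
  refine Set.Subset.antisymm (fun c hc => ?_) fun c hc E F _ _ _ _ _ _ => hc.exists_g E F
  have hc0 : 0 ≤ c := by
    obtain ⟨g, -, hg⟩ := hc PUnit PUnit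
    exact (norm_nonneg g).trans hg
  refine mapBound_of_gBound hc0 fun E F _ _ _ _ _ _ => ?_
  obtain ⟨g, hg, hg'⟩ := hc E F
  exact hg.gBound.mono hg'

end STensorNorm

end Injective

end BanachTensor

end

theorem mainTheorem5 {𝕜 : Type} [RCLike 𝕜] {n : ℕ} (hn : 1 ≤ n)
    (β : BanachTensor.STensorNorm.{u} 𝕜 n) :
    List.TFAE [β.PreservesBanachAlgebras, β.HasNaturalF, β.HasNaturalG, β.HasNaturalH] ∧
    (β.PreservesBanachAlgebras →
      ∃ c : ℝ, IsLeast β.algebraConstants c ∧ IsLeast β.fConstants c ∧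
        IsLeast β.gConstants c ∧ IsLeast β.hConstants c) := by
  refine ⟨List.tfae_of_forall (∃ c, β.MapBound c) _ ?_, fun h => ?_⟩
  · simp [β.preservesBanachAlgebras_iff, β.hasNaturalF_iff, β.hasNaturalG_iff, β.hasNaturalH_iff]
  · rw [β.algebraConstants_eq, β.fConstants_eq, β.gConstants_eq, β.hConstants_eq]
    obtain ⟨c, hc⟩ := β.exists_isLeast_mapBound (β.preservesBanachAlgebras_iff.1 h)
    exact ⟨c, hc, hc, hc, hc⟩
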